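/- **Quartic Jacobi symbol.** For a prime $\pi$ of $\mathbb Z[i]$ with $\pi\nmid 2$ and $\alpha\in\mathbb Z[i]$, let $\left(\frac{\alpha}{\pi}\right)_4=0$ if $\pi\mid\alpha$, and otherwise let it be the unique $u\in\{1,i,-1,-i\}$ with $\alpha^{(N\pi-1)/4}\equiv u\pmod \pi$. For $\beta\in\mathbb Z[i]$ of odd norm with $\beta=\varepsilon\pi_1\cdots\pi_r$ ($\varepsilon$ a unit, $\pi_j$ prime), put $\left(\frac{\alpha}{\beta}\right)_4=\prod_j\left(\frac{\alpha}{\pi_j}\right)_4$, and for a nonzero integer $D$ prime to $\beta$ put $\left(\frac{\alpha/D}{\beta}\right)_4=\left(\frac{\alpha}{\beta}\right)_4\left(\frac{D}{\beta}\right)_4^{-1}$. **Theorem 3.1.** Let $p\equiv 1\pmod 4$ be a prime and let $q\in\mathbb Z$ satisfy $q\equiv 3\pmod 8$ and $p\nmid q$. Suppose that $p=c^2+d^2$ and $4p=x^2+qy^2$ with $c,d,x,y\in\mathbb Z$, $c\equiv y\equiv 1\pmod 4$ and $\gcd(c,x+2d)=1$, and let $k\in\mathbb Z$ be such that $$\left(\frac{\frac{2c}{x+2d}+i}{q}\right)_4=i^k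 .$$ Then $$(-q)^{[p/8]}\equiv\begin{cases}(-1)^{[\frac x4]+\frac{q-3}8}\left(\dfrac dc\right)^{k-1}\pmod p&\text{if } p\equiv 1\pmod 8,\\[2mm] -(-1)^{\frac{x^2-1}8+\frac{q-3}8}\left(\dfrac dc\right)^{k-1}\dfrac yx\pmod p&\text{if } p\equiv 5\pmod 8,\end{cases}$$ where $[\cdot]$ is the greatest integer function and the fractions are read modulo $p$ ($c,d,x$ are prime to $p$). -/

import Mathlib

open Classical in
/-- The quartic residue symbol of `α` modulo a Gaussian prime `π` not dividing `2`:
it is `0` if `π ∣ α`, and otherwise the unique `u ∈ {1, i, -1, -i}` with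
`α ^ ((N π - 1) / 4) ≡ u (mod π)`. -/
noncomputable def quarticResidueSymbol (α π : GaussianInt) : GaussianInt :=
  let n : ℕ := (π.norm.natAbs - 1) / 4
  let i : GaussianInt := ⟨0, 1⟩
  if π ∣ α then 0
  else if π ∣ α ^ n - 1 then 1
  else if π ∣ α ^ n - i then i
  else if π ∣ α ^ n - (-1) then -1
  else if π ∣ α ^ n - (-i) then -i
  else 0

/-- The quartic Jacobi symbol of `α` modulo `β`, for a Gaussian integer `β` of odd norm: the product
of the quartic residue symbols of `α` modulo the prime factors of `β`, with multiplicity.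
The residue symbol modulo `π` does not change when `π` is replaced by an associate, so neither the
choice of the prime factors nor a unit factor of `β` matters. The symbol is `1` if `β` is a unit. -/
noncomputable def quarticJacobiSymbol (α β : GaussianInt) : GaussianInt :=
  ((UniqueFactorizationMonoid.factors β).map (quarticResidueSymbol α)).prod

/-- The quartic Jacobi symbol of `a + b i` modulo `β`, for `β` of odd norm and rational numbers
`a`, `b` whose denominators are prime to `β`. With the common denominator `D` of `a` and `b`, it is
the symbol of the Gaussian integer `D (a + b i)` divided by the symbol of `D`; the latter is one of
`1, i, -1, -i`, so its inverse is its conjugate. -/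
noncomputable def quarticJacobiSymbolRat (a b : ℚ) (β : GaussianInt) : GaussianInt :=
  quarticJacobiSymbol ⟨a.num * b.den, b.num * a.den⟩ β *
    star (quarticJacobiSymbol ((a.den * b.den : ℕ) : GaussianInt) β)

/-!
For `β` congruent to `1` modulo `2` and an odd integer `n` prime to `β`, quartic reciprocity says
`(n* / β)₄ = (β / n)₄`, where `n* = ±n` is congruent to `1` modulo `4`. For primes `l ∣ n` and
`π ∣ β` it comes from comparing two values of the `l`-th power of the quartic Gauss sum modulo `π`
in characteristic `l`: by Frobenius, and from its known fourth power.

Put `π = c + d i` and `Λ = x + 2 d - 2 c i`, the numerator of `2 c / (x + 2 d) + i` up to a unit.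
Since `4 p = x ^ 2 + q y ^ 2`, the norm of `Λ` is `2 x (x + 2 d) + q y ^ 2`, so
`(-q / Λ)₄ (y / Λ)₄ ^ 2 = (2 x (x + 2 d) / Λ)₄`. By reciprocity `(-q / Λ)₄ = (Λ / q)₄`, while
`Λ ^ 2` modulo `y` and `Λ` modulo `x` are integer multiples of `i π`, so `(y / Λ)₄ ^ 2` and
`(x / Λ)₄` become `(y / π)₄` and `(x / π)₄` up to sign. Finally `-q` is `(x / y) ^ 2` modulo `p`,
and modulo `π` the power `(x / y) ^ ((p - 1) / 4)` is the quotient of these two symbols; the map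
`ℤ[i] → ℤ/p` that kills `π` sends `i` to `d / c`.
-/

namespace QuarticReciprocity

/-! ### Norms and units of `ℤ[i]` -/

/-- The imaginary unit of `ℤ[i]`. -/
abbrev I : GaussianInt := ⟨0, 1⟩

theorem I_mul_I : I * I = -1 := by decide

theorem I_pow_four : I ^ 4 = 1 := by decide

theorem pow_four_eq_one_iff {s : GaussianInt} : s ^ 4 = 1 ↔ s = 1 ∨ s = I ∨ s = -1 ∨ s = -I := by
  constructor
  · intro h
    have : (s - 1) * ((s - I) * ((s - -1) * (s - -I))) = 0 := by
      linear_combination h - (s ^ 2 - 1) * I_mul_I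
    simpa only [mul_eq_zero, sub_eq_zero] using this
  · rintro (rfl | rfl | rfl | rfl) <;> decide

theorem star_mul_self_of_pow_four_eq_one {s : GaussianInt} (h : s ^ 4 = 1) : star s * s = 1 := by
  rcases pow_four_eq_one_iff.1 h with rfl | rfl | rfl | rfl <;> decide

theorem norm_eq_re_sq_add_im_sq (α : GaussianInt) : α.norm = α.re ^ 2 + α.im ^ 2 := by
  rw [Zsqrtd.norm_def]
  ring

theorem pow_four_eq_one_of_isUnit {u : GaussianInt} (hu : IsUnit u) : u ^ 4 = 1 := by
  have hnorm : u.re ^ 2 + u.im ^ 2 = 1 := by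
    rw [← norm_eq_re_sq_add_im_sq, Zsqrtd.norm_eq_one_iff' (by norm_num)]
    exact hu
  have hre : u.re ∈ Set.Icc (-1) 1 := abs_le.1 (sq_le_one_iff_abs_le_one _ |>.1 (by nlinarith))
  have him : u.im ∈ Set.Icc (-1) 1 := abs_le.1 (sq_le_one_iff_abs_le_one _ |>.1 (by nlinarith))
  obtain ⟨a, b⟩ := u
  obtain ⟨ha₁, ha₂⟩ := hre
  obtain ⟨hb₁, hb₂⟩ := him
  dsimp only at *
  interval_cases a <;> interval_cases b <;> first | decide | omega

theorem ne_zero_of_odd_norm {α : GaussianInt} (h : Odd α.norm) : α ≠ 0 := by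
  rintro rfl
  simp at h

theorem odd_norm_intCast {n : ℤ} (hn : Odd n) : Odd (n : GaussianInt).norm := by
  rw [Zsqrtd.norm_intCast]
  exact hn.mul hn

theorem isUnit_intCast {u : ℤ} (hu : IsUnit u) : IsUnit (u : GaussianInt) :=
  hu.map (Int.castRingHom GaussianInt)

theorem odd_norm_star {α : GaussianInt} (h : Odd α.norm) : Odd (star α).norm := by
  rwa [Zsqrtd.norm_conj]

theorem prime_star {π : GaussianInt} (hπ : Prime π) : Prime (star π) :=
  (MulEquiv.prime_iff (starRingAut (R := GaussianInt))).2 (by simpa using hπ)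

theorem star_dvd_star {α β : GaussianInt} (h : α ∣ β) : star α ∣ star β :=
  map_dvd (starRingEnd GaussianInt) h

theorem prime_of_prime_norm {π : GaussianInt} {p : ℕ} (hp : p.Prime) (h : π.norm = p) :
    Prime π := by
  have hirr : Irreducible π.norm.natAbs := by
    rw [h, Int.natAbs_natCast]
    exact hp
  refine Irreducible.prime ⟨fun hu => ?_, fun α β hαβ => ?_⟩
  · refine hirr.not_isUnit ?_
    exact Nat.isUnit_iff.2 (Zsqrtd.norm_eq_one_iff.2 hu)
  · simp only [← Zsqrtd.norm_eq_one_iff, ← Nat.isUnit_iff]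
    exact hirr.isUnit_or_isUnit (by rw [hαβ, Zsqrtd.norm_mul, Int.natAbs_mul])

theorem not_dvd_of_isCoprime {π α : GaussianInt} (hπ : Prime π) (h : IsCoprime α π) : ¬ π ∣ α :=
  fun hα => hπ.not_isUnit (h.isUnit_of_dvd' hα dvd_rfl)

theorem isCoprime_intCast_of_isCoprime_norm {n : ℤ} {β : GaussianInt} (h : IsCoprime n β.norm) :
    IsCoprime (n : GaussianInt) β := by
  have := h.map (Int.castRingHom GaussianInt)
  rw [eq_intCast, eq_intCast, Zsqrtd.norm_eq_mul_conj] at this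
  exact this.of_mul_right_left

theorem isCoprime_intCast_intCast {m n : ℤ} (h : IsCoprime m n) :
    IsCoprime (m : GaussianInt) (n : GaussianInt) := by
  simpa using h.map (Int.castRingHom GaussianInt)

theorem associated_intCast_natAbs (n : ℤ) :
    Associated (n : GaussianInt) (n.natAbs : GaussianInt) := by
  simpa using (Int.associated_natAbs n).map (Int.castRingHom GaussianInt)

theorem not_dvd_two {π : GaussianInt} (hπ : Prime π) (hodd : Odd π.norm) : ¬ π ∣ 2 := by
  intro h
  have hdvd : π.norm ∣ 2 ^ 2 := map_dvd Zsqrtd.normMonoidHom h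
  have hcop : IsCoprime π.norm (2 ^ 2) := (Int.isCoprime_two_right.2 hodd).pow_right
  exact hπ.not_isUnit ((Zsqrtd.isUnit_iff_norm_isUnit π).2 (hcop.isUnit_of_dvd' dvd_rfl hdvd))

theorem eq_of_pow_four_eq_one_of_dvd_sub {π s t : GaussianInt} (hπ : Prime π) (hodd : Odd π.norm)
    (hs : s ^ 4 = 1) (ht : t ^ 4 = 1) (h : π ∣ s - t) : s = t := by
  by_contra hne
  have hst : (s - t) * star (s - t) = 2 ∨ (s - t) * star (s - t) = 2 * 2 := by
    rcases pow_four_eq_one_iff.1 hs with rfl | rfl | rfl | rfl <;>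
      rcases pow_four_eq_one_iff.1 ht with rfl | rfl | rfl | rfl <;> revert hne <;> decide
  have hdvd := h.mul_right (star (s - t))
  rcases hst with hst | hst <;> rw [hst] at hdvd
  · exact not_dvd_two hπ hodd hdvd
  · exact not_dvd_two hπ hodd ((hπ.dvd_or_dvd hdvd).elim id id)

/-- The exponent `(N π - 1) / 4` in the definition of the quartic residue symbol modulo `π`. The
division is exact when `N π` is odd. -/
def quarticExponent (π : GaussianInt) : ℕ := (π.norm.natAbs - 1) / 4

theorem natAbs_norm_eq_four_mul_add_one {π : GaussianInt} (hodd : Odd π.norm) :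
    π.norm.natAbs = 4 * quarticExponent π + 1 := by
  have hmod : π.norm % 4 = 1 := by
    rw [norm_eq_re_sq_add_im_sq, Int.odd_add, Int.odd_pow' two_ne_zero,
      Int.even_pow' two_ne_zero] at hodd
    rw [norm_eq_re_sq_add_im_sq]
    rcases Int.even_or_odd π.re with hre | hre
    · have him := Int.not_even_iff_odd.1 fun him => Int.not_even_iff_odd.2 (hodd.2 him) hre
      have := Int.sq_mod_four_eq_one_of_odd him
      obtain ⟨a, ha⟩ := hre
      rw [ha, show (a + a) ^ 2 = 4 * (a * a) by ring]
      omega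
    · have := Int.sq_mod_four_eq_one_of_odd hre
      obtain ⟨b, hb⟩ := hodd.1 hre
      rw [hb, show (b + b) ^ 2 = 4 * (b * b) by ring]
      omega
  have := GaussianInt.norm_nonneg π
  rw [quarticExponent]
  omega

theorem quarticExponent_ne_zero {π : GaussianInt} (hπ : Prime π) (hodd : Odd π.norm) :
    quarticExponent π ≠ 0 := by
  intro h
  have hnorm := natAbs_norm_eq_four_mul_add_one hodd
  rw [h] at hnorm
  exact hπ.not_isUnit (Zsqrtd.norm_eq_one_iff.1 hnorm)

/-- A Gaussian integer congruent to `1` modulo `2`. Every Gaussian integer of odd norm has such an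
associate, and it is unique up to sign. -/
def IsSemiprimary (β : GaussianInt) : Prop := Odd β.re ∧ Even β.im

namespace IsSemiprimary

variable {α β : GaussianInt}

theorem intCast {n : ℤ} (hn : Odd n) : IsSemiprimary (n : GaussianInt) := by
  simpa [IsSemiprimary] using hn

theorem neg (hβ : IsSemiprimary β) : IsSemiprimary (-β) :=
  ⟨by simpa using hβ.1.neg, by simpa using hβ.2.neg⟩

theorem mul (hα : IsSemiprimary α) (hβ : IsSemiprimary β) : IsSemiprimary (α * β) := by
  constructor
  · rw [Zsqrtd.re_mul]
    exact (hα.1.mul hβ.1).add_even (hβ.2.mul_left _)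
  · rw [Zsqrtd.im_mul]
    exact (hβ.2.mul_left _).add (hα.2.mul_right _)

theorem odd_norm (hβ : IsSemiprimary β) : Odd β.norm := by
  rw [norm_eq_re_sq_add_im_sq]
  exact hβ.1.pow.add_even (hβ.2.pow_of_ne_zero two_ne_zero)

theorem eq_or_eq_neg_of_associated (hα : IsSemiprimary α) (hβ : IsSemiprimary β)
    (h : Associated α β) : β = α ∨ β = -α := by
  obtain ⟨u, rfl⟩ := h
  have hre := Int.not_even_iff_odd.2 hα.1
  have him := hβ.2
  rcases pow_four_eq_one_iff.1 (pow_four_eq_one_of_isUnit u.isUnit) with hu | hu | hu | hu <;>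
    rw [hu] at him ⊢
  · exact Or.inl (mul_one α)
  · exact absurd (by simpa using him) hre
  · exact Or.inr (mul_neg_one α)
  · exact absurd (by simpa using him) hre

end IsSemiprimary

theorem exists_associated_isSemiprimary {β : GaussianInt} (hodd : Odd β.norm) :
    ∃ γ, Associated β γ ∧ IsSemiprimary γ := by
  rw [norm_eq_re_sq_add_im_sq, Int.odd_add, Int.odd_pow' two_ne_zero,
    Int.even_pow' two_ne_zero] at hodd
  rcases Int.even_or_odd β.re with hre | hre
  · have him := Int.not_even_iff_odd.1 fun him => Int.not_even_iff_odd.2 (hodd.2 him) hre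
    have hI : IsUnit I := IsUnit.of_pow_eq_one I_pow_four four_ne_zero
    exact ⟨β * I, (associated_mul_unit_right β I hI),
      by simpa [IsSemiprimary] using ⟨him, hre⟩⟩
  · exact ⟨β, Associated.refl β, hre, hodd.1 hre⟩

theorem odd_norm_induction {P : GaussianInt → Prop} (unit : ∀ u, IsUnit u → P u)
    (prime_mul : ∀ π β, Prime π → Odd π.norm → Odd β.norm → P β → P (π * β)) {β : GaussianInt}
    (hβ : Odd β.norm) : P β := by
  induction β using UniqueFactorizationMonoid.induction_on_prime with
  | h₁ => simp at hβ
  | h₂ u hu => exact unit u hu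
  | h₃ β π _ hπ ih =>
    rw [Zsqrtd.norm_mul, Int.odd_mul] at hβ
    exact prime_mul π β hπ hβ.1 hβ.2 (ih hβ.2)

theorem semiprimary_induction {P : GaussianInt → Prop} (one : P 1) (neg_one : P (-1))
    (prime_mul : ∀ π β, Prime π → IsSemiprimary π → IsSemiprimary β → P β → P (π * β))
    {β : GaussianInt} (hβ : IsSemiprimary β) : P β := by
  suffices ∀ γ, Associated β γ → IsSemiprimary γ → P γ from this β (Associated.refl β) hβ
  refine odd_norm_induction (P := fun β => ∀ γ, Associated β γ → IsSemiprimary γ → P γ)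
    (fun u hu γ huγ hγ => ?_) (fun π β hπ hπodd hβodd ih γ hπβγ hγ => ?_) hβ.odd_norm
  · have h1 : IsSemiprimary 1 := by simpa using IsSemiprimary.intCast odd_one
    have h1γ : Associated 1 γ := (associated_one_iff_isUnit.2 hu).symm.trans huγ
    rcases h1.eq_or_eq_neg_of_associated hγ h1γ with rfl | rfl
    exacts [one, neg_one]
  · obtain ⟨π', hπ', hπ's⟩ := exists_associated_isSemiprimary hπodd
    obtain ⟨β', hβ', hβ's⟩ := exists_associated_isSemiprimary hβodd
    have hassoc : Associated (π' * β') γ := (hπ'.mul_mul hβ').symm.trans hπβγ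
    rcases (hπ's.mul hβ's).eq_or_eq_neg_of_associated hγ hassoc with rfl | rfl
    · exact prime_mul π' β' (hπ'.prime hπ) hπ's hβ's (ih β' hβ' hβ's)
    · rw [← mul_neg]
      exact prime_mul π' (-β') (hπ'.prime hπ) hπ's hβ's.neg
        (ih (-β') (hβ'.trans (Associated.neg_right (Associated.refl β'))) hβ's.neg)

theorem odd_int_induction {P : ℤ → Prop} (unit : ∀ u, IsUnit u → P u)
    (prime_mul : ∀ l n : ℤ, l.natAbs.Prime → Odd l → Odd n → P n → P (l * n)) {n : ℤ}
    (hn : Odd n) : P n := by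
  induction n using UniqueFactorizationMonoid.induction_on_prime with
  | h₁ => simp at hn
  | h₂ u hu => exact unit u hu
  | h₃ n l _ hl ih =>
    rw [Int.odd_mul] at hn
    exact prime_mul l n (Int.prime_iff_natAbs_prime.1 hl) hn.1 hn.2 (ih hn.2)

/-! ### The residue field and the quartic residue symbol -/

/-- The homomorphism `φ` realizes the field `F` as the residue ring `ℤ[i]/(π)`. -/
structure IsResidueField {F : Type*} [Field F] (φ : GaussianInt →+* F) (π : GaussianInt) :
    Prop where
  surjective : Function.Surjective φ
  map_eq_zero_iff : ∀ α, φ α = 0 ↔ π ∣ α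

/-- The basis `1, i` of `ℤ[i]` over `ℤ`. -/
noncomputable def basisOneI : Module.Basis (Fin 2) ℤ GaussianInt :=
  .ofEquivFun
    { toFun := fun α => ![α.re, α.im]
      invFun := fun v => ⟨v 0, v 1⟩
      map_add' := fun α β => by ext j; fin_cases j <;> simp
      map_smul' := fun n α => by ext j; fin_cases j <;> simp
      left_inv := fun α => by simp
      right_inv := fun v => by ext j; fin_cases j <;> simp }

theorem algebraNorm_eq_norm (α : GaussianInt) : Algebra.norm ℤ α = α.norm := by
  rw [Algebra.norm_eq_matrix_det basisOneI, Matrix.det_fin_two]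
  simp [Algebra.leftMulMatrix_eq_repr_mul, basisOneI, Zsqrtd.norm_def]

theorem card_quotient_span_singleton (π : GaussianInt) :
    Nat.card (GaussianInt ⧸ Ideal.span {π}) = π.norm.natAbs := by
  have : Module.Free ℤ GaussianInt := .of_basis basisOneI
  have : Module.Finite ℤ GaussianInt := .of_basis basisOneI
  rw [← algebraNorm_eq_norm, ← Ideal.absNorm_span_singleton, Ideal.absNorm_apply,
    Submodule.cardQuot_apply]

theorem exists_isResidueField {π : GaussianInt} (hπ : Prime π) :
    ∃ (F : Type) (_ : Field F) (_ : Fintype F) (φ : GaussianInt →+* F), IsResidueField φ π := by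
  have hmax : (Ideal.span {π}).IsMaximal :=
    PrincipalIdealRing.isMaximal_of_irreducible hπ.irreducible
  have : Finite (GaussianInt ⧸ Ideal.span {π}) := by
    refine Nat.finite_of_card_ne_zero ?_
    rw [card_quotient_span_singleton, Int.natAbs_ne_zero, Ne, GaussianInt.norm_eq_zero]
    exact hπ.ne_zero
  let := Ideal.Quotient.field (Ideal.span {π})
  exact ⟨_, inferInstance, Fintype.ofFinite _, Ideal.Quotient.mk (Ideal.span {π}),
    Ideal.Quotient.mk_surjective, fun α => by
      rw [Ideal.Quotient.eq_zero_iff_mem, Ideal.mem_span_singleton]⟩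

namespace IsResidueField

variable {F : Type*} [Field F] {φ : GaussianInt →+* F} {π α β : GaussianInt}

theorem map_eq_iff (hφ : IsResidueField φ π) : φ α = φ β ↔ π ∣ α - β := by
  rw [← hφ.map_eq_zero_iff, map_sub, sub_eq_zero]

theorem prime [Finite F] (hφ : IsResidueField φ π) : Prime π := by
  refine ⟨fun h => ?_, fun h => ?_, fun α β h => ?_⟩
  · have hinj : Function.Injective φ := (injective_iff_map_eq_zero φ).2 fun α hα =>
      zero_dvd_iff.1 (h ▸ (hφ.map_eq_zero_iff α).1 hα)
    exact not_injective_infinite_finite φ hinj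
  · exact one_ne_zero (φ.map_one.symm.trans ((hφ.map_eq_zero_iff 1).2 (isUnit_iff_dvd_one.1 h)))
  · simpa only [← hφ.map_eq_zero_iff, map_mul, mul_eq_zero] using h

theorem ringChar_ne_two [Finite F] (hφ : IsResidueField φ π) (hodd : Odd π.norm) :
    ringChar F ≠ 2 := by
  intro h
  refine not_dvd_two hφ.prime hodd ((hφ.map_eq_zero_iff 2).1 ?_)
  rw [map_ofNat, ← Nat.cast_ofNat, ← h, ringChar.Nat.cast_ringChar]

variable [Fintype F]

theorem card_eq (hφ : IsResidueField φ π) : Fintype.card F = π.norm.natAbs := by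
  have hker : RingHom.ker φ = Ideal.span {π} := by
    ext α
    rw [RingHom.mem_ker, hφ.map_eq_zero_iff, Ideal.mem_span_singleton]
  rw [← card_quotient_span_singleton, ← hker, ← Nat.card_eq_fintype_card]
  exact Nat.card_congr (RingHom.quotientKerEquivOfSurjective hφ.surjective).symm.toEquiv

theorem card_eq_four_mul_add_one (hφ : IsResidueField φ π) (hodd : Odd π.norm) :
    Fintype.card F = 4 * quarticExponent π + 1 :=
  hφ.card_eq.trans (natAbs_norm_eq_four_mul_add_one hodd)

end IsResidueField

section ResidueSymbol

variable {π α β s : GaussianInt}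

theorem quarticResidueSymbol_of_dvd (h : π ∣ α) : quarticResidueSymbol α π = 0 := by
  simp [quarticResidueSymbol, h]

theorem dvd_pow_four_mul_quarticExponent_sub_one (hπ : Prime π) (hodd : Odd π.norm)
    (h : ¬ π ∣ α) : π ∣ α ^ (4 * quarticExponent π) - 1 := by
  obtain ⟨F, _, _, φ, hφ⟩ := exists_isResidueField hπ
  have hα : φ α ≠ 0 := by rwa [Ne, hφ.map_eq_zero_iff]
  have hfermat := FiniteField.pow_card_sub_one_eq_one _ hα
  rw [hφ.card_eq_four_mul_add_one hodd, Nat.add_sub_cancel] at hfermat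
  rw [← hφ.map_eq_iff, map_pow, map_one, hfermat]

theorem quarticResidueSymbol_spec (hπ : Prime π) (hodd : Odd π.norm) (h : ¬ π ∣ α) :
    quarticResidueSymbol α π ^ 4 = 1 ∧
      π ∣ α ^ quarticExponent π - quarticResidueSymbol α π := by
  have hdvd := dvd_pow_four_mul_quarticExponent_sub_one hπ hodd h
  rw [mul_comm, pow_mul] at hdvd
  unfold quarticExponent at *
  set t := α ^ ((π.norm.natAbs - 1) / 4) with ht
  have hfactor : t ^ 4 - 1 = (t - 1) * ((t - I) * ((t - -1) * (t - -I))) := by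
    linear_combination (t ^ 2 - 1) * I_mul_I
  rw [hfactor] at hdvd
  have hroots := (hπ.dvd_or_dvd hdvd).imp_right fun h =>
    (hπ.dvd_or_dvd h).imp_right hπ.dvd_or_dvd
  simp only [quarticResidueSymbol, if_neg h, ← ht]
  split_ifs with h₁ h₂ h₃ h₄
  · exact ⟨one_pow 4, h₁⟩
  · exact ⟨I_pow_four, h₂⟩
  · exact ⟨by decide, h₃⟩
  · exact ⟨by decide, h₄⟩
  · tauto

theorem dvd_pow_quarticExponent_sub (hπ : Prime π) (hodd : Odd π.norm) (α : GaussianInt) :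
    π ∣ α ^ quarticExponent π - quarticResidueSymbol α π := by
  by_cases h : π ∣ α
  · rw [quarticResidueSymbol_of_dvd h, sub_zero]
    exact dvd_pow h (quarticExponent_ne_zero hπ hodd)
  · exact (quarticResidueSymbol_spec hπ hodd h).2

theorem map_pow_quarticExponent {R : Type*} [CommRing R] {θ : GaussianInt →+* R} (hπ : Prime π)
    (hodd : Odd π.norm) (hθ : θ π = 0) (α : GaussianInt) :
    θ α ^ quarticExponent π = θ (quarticResidueSymbol α π) := by
  have h := map_dvd θ (dvd_pow_quarticExponent_sub hπ hodd α)
  rwa [hθ, zero_dvd_iff, map_sub, map_pow, sub_eq_zero] at h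

theorem quarticResidueSymbol_eq_of_dvd (hπ : Prime π) (hodd : Odd π.norm) (hs : s ^ 4 = 1)
    (h : π ∣ α ^ quarticExponent π - s) : quarticResidueSymbol α π = s := by
  have hα : ¬ π ∣ α := by
    intro hα
    have hπs : π ∣ s := (dvd_iff_dvd_of_dvd_sub h).1 (dvd_pow hα (quarticExponent_ne_zero hπ hodd))
    exact hπ.not_isUnit (isUnit_of_dvd_unit hπs (IsUnit.of_pow_eq_one hs four_ne_zero))
  obtain ⟨hpow, hdvd⟩ := quarticResidueSymbol_spec hπ hodd hα
  refine eq_of_pow_four_eq_one_of_dvd_sub hπ hodd hpow hs ?_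
  simpa only [sub_sub_sub_cancel_left] using dvd_sub h hdvd

theorem quarticResidueSymbol_mul (hπ : Prime π) (hodd : Odd π.norm) (α β : GaussianInt) :
    quarticResidueSymbol (α * β) π = quarticResidueSymbol α π * quarticResidueSymbol β π := by
  by_cases hα : π ∣ α
  · rw [quarticResidueSymbol_of_dvd hα, zero_mul, quarticResidueSymbol_of_dvd (hα.mul_right β)]
  by_cases hβ : π ∣ β
  · rw [quarticResidueSymbol_of_dvd hβ, mul_zero, quarticResidueSymbol_of_dvd (hβ.mul_left α)]
  obtain ⟨hαpow, hαdvd⟩ := quarticResidueSymbol_spec hπ hodd hα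
  obtain ⟨hβpow, hβdvd⟩ := quarticResidueSymbol_spec hπ hodd hβ
  refine quarticResidueSymbol_eq_of_dvd hπ hodd (by rw [mul_pow, hαpow, hβpow, one_mul]) ?_
  rw [mul_pow]
  exact dvd_mul_sub_mul hαdvd hβdvd

theorem quarticResidueSymbol_congr (hπ : Prime π) (hodd : Odd π.norm) (h : π ∣ α - β) :
    quarticResidueSymbol α π = quarticResidueSymbol β π := by
  by_cases hβ : π ∣ β
  · rw [quarticResidueSymbol_of_dvd hβ,
      quarticResidueSymbol_of_dvd ((dvd_iff_dvd_of_dvd_sub h).2 hβ)]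
  obtain ⟨hpow, hdvd⟩ := quarticResidueSymbol_spec hπ hodd hβ
  refine quarticResidueSymbol_eq_of_dvd hπ hodd hpow ?_
  simpa only [sub_add_sub_cancel] using
    dvd_add (h.trans (sub_dvd_pow_sub_pow α β (quarticExponent π))) hdvd

theorem quarticResidueSymbol_associated {ρ : GaussianInt} (h : Associated π ρ)
    (α : GaussianInt) : quarticResidueSymbol α π = quarticResidueSymbol α ρ := by
  classical
  simp only [quarticResidueSymbol, Zsqrtd.norm_eq_of_associated (by norm_num) h,
    h.dvd_iff_dvd_left]

theorem quarticResidueSymbol_star (hπ : Prime π) (hodd : Odd π.norm) (α : GaussianInt) :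
    quarticResidueSymbol (star α) (star π) = star (quarticResidueSymbol α π) := by
  by_cases hα : π ∣ α
  · rw [quarticResidueSymbol_of_dvd hα, quarticResidueSymbol_of_dvd (star_dvd_star hα), star_zero]
  obtain ⟨hpow, hdvd⟩ := quarticResidueSymbol_spec hπ hodd hα
  refine quarticResidueSymbol_eq_of_dvd (prime_star hπ) (odd_norm_star hodd) ?_ ?_
  · rw [← star_pow, hpow, star_one]
  · rw [quarticExponent, Zsqrtd.norm_conj, ← star_pow, ← star_sub]
    exact star_dvd_star hdvd

end ResidueSymbol

/-! ### The quartic Jacobi symbol -/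

local notation "J₄(" α ", " β ")" => quarticJacobiSymbol α β

theorem quarticJacobiSymbol_isUnit {u : GaussianInt} (hu : IsUnit u) (α : GaussianInt) :
    J₄(α, u) = 1 := by
  have hfactors : UniqueFactorizationMonoid.factors u = 0 := by
    refine Multiset.eq_zero_of_forall_notMem fun π hπ => ?_
    exact (UniqueFactorizationMonoid.prime_of_factor π hπ).not_isUnit
      (isUnit_of_dvd_unit (UniqueFactorizationMonoid.dvd_of_mem_factors hπ) hu)
  rw [quarticJacobiSymbol, hfactors, Multiset.map_zero, Multiset.prod_zero]

theorem quarticJacobiSymbol_prime {π : GaussianInt} (hπ : Prime π) (α : GaussianInt) :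
    J₄(α, π) = quarticResidueSymbol α π := by
  obtain ⟨ρ, hρ, hfactors⟩ :=
    UniqueFactorizationMonoid.factors_eq_singleton_of_irreducible hπ.irreducible
  rw [quarticJacobiSymbol, hfactors, Multiset.map_singleton, Multiset.prod_singleton,
    quarticResidueSymbol_associated hρ]

theorem quarticJacobiSymbol_mul_right (α : GaussianInt) {β γ : GaussianInt} (hβ : β ≠ 0)
    (hγ : γ ≠ 0) : J₄(α, β * γ) = J₄(α, β) * J₄(α, γ) := by
  simp only [quarticJacobiSymbol]
  rw [← Multiset.prod_add, ← Multiset.map_add]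
  congr 1
  rw [← Multiset.rel_eq, Multiset.rel_map]
  exact (UniqueFactorizationMonoid.factors_mul hβ hγ).mono
    fun π _ ρ _ hπρ => quarticResidueSymbol_associated hπρ α

theorem quarticJacobiSymbol_associated {β γ : GaussianInt} (h : Associated β γ)
    (α : GaussianInt) : J₄(α, β) = J₄(α, γ) := by
  obtain ⟨u, rfl⟩ := h
  by_cases hβ : β = 0
  · rw [hβ, zero_mul]
  · rw [quarticJacobiSymbol_mul_right α hβ u.ne_zero, quarticJacobiSymbol_isUnit u.isUnit, mul_one]

theorem quarticJacobiSymbol_prime_mul {π β : GaussianInt} (hπ : Prime π) (hβ : Odd β.norm)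
    (α : GaussianInt) : J₄(α, π * β) = quarticResidueSymbol α π * J₄(α, β) := by
  rw [quarticJacobiSymbol_mul_right α hπ.ne_zero (ne_zero_of_odd_norm hβ),
    quarticJacobiSymbol_prime hπ]

section

variable {β : GaussianInt}

theorem quarticJacobiSymbol_mul (hβ : Odd β.norm) (α γ : GaussianInt) :
    J₄(α * γ, β) = J₄(α, β) * J₄(γ, β) := by
  refine odd_norm_induction (P := fun β => J₄(α * γ, β) = J₄(α, β) * J₄(γ, β))
    (fun u hu => ?_) (fun π β hπ hodd hβ ih => ?_) hβ
  · simp only [quarticJacobiSymbol_isUnit hu, mul_one]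
  · simp only [quarticJacobiSymbol_prime_mul hπ hβ, quarticResidueSymbol_mul hπ hodd, ih]
    ring

theorem quarticJacobiSymbol_congr (hβ : Odd β.norm) {α γ : GaussianInt} (h : β ∣ α - γ) :
    J₄(α, β) = J₄(γ, β) := by
  refine odd_norm_induction (P := fun β => β ∣ α - γ → J₄(α, β) = J₄(γ, β))
    (fun u hu _ => ?_) (fun π β hπ hodd hβ ih h => ?_) hβ h
  · simp only [quarticJacobiSymbol_isUnit hu]
  · rw [quarticJacobiSymbol_prime_mul hπ hβ, quarticJacobiSymbol_prime_mul hπ hβ,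
      quarticResidueSymbol_congr hπ hodd (dvd_of_mul_right_dvd h), ih (dvd_of_mul_left_dvd h)]

theorem quarticJacobiSymbol_one (hβ : Odd β.norm) : J₄(1, β) = 1 := by
  refine odd_norm_induction (P := fun β => J₄(1, β) = 1) (fun u hu => ?_)
    (fun π β hπ hodd hβ ih => ?_) hβ
  · exact quarticJacobiSymbol_isUnit hu 1
  · rw [quarticJacobiSymbol_prime_mul hπ hβ, ih, mul_one]
    exact quarticResidueSymbol_eq_of_dvd hπ hodd (one_pow 4) (by simp)

theorem quarticJacobiSymbol_I (hβ : Odd β.norm) : J₄(I, β) = I ^ quarticExponent β := by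
  refine odd_norm_induction (P := fun β => J₄(I, β) = I ^ quarticExponent β)
    (fun u hu => ?_) (fun π β hπ hπodd hβ ih => ?_) hβ
  · rw [quarticJacobiSymbol_isUnit hu, quarticExponent, Zsqrtd.norm_eq_one_iff.2 hu, Nat.sub_self,
      Nat.zero_div, pow_zero]
  have hπsymbol : quarticResidueSymbol I π = I ^ quarticExponent π :=
    quarticResidueSymbol_eq_of_dvd hπ hπodd
      (by rw [← pow_mul, mul_comm, pow_mul, I_pow_four, one_pow])
      (by rw [sub_self]; exact dvd_zero π)
  have hexp : quarticExponent (π * β) = 4 * (quarticExponent π * quarticExponent β) +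
      (quarticExponent π + quarticExponent β) := by
    have := natAbs_norm_eq_four_mul_add_one (π := π * β)
      (by rw [Zsqrtd.norm_mul]; exact hπodd.mul hβ)
    rw [Zsqrtd.norm_mul, Int.natAbs_mul, natAbs_norm_eq_four_mul_add_one hπodd,
      natAbs_norm_eq_four_mul_add_one hβ] at this
    linarith
  rw [quarticJacobiSymbol_prime_mul hπ hβ, ih, hπsymbol, hexp, pow_add, pow_mul, I_pow_four,
    one_pow, one_mul, pow_add]

theorem quarticJacobiSymbol_pow (hβ : Odd β.norm) (α : GaussianInt) (n : ℕ) :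
    J₄(α ^ n, β) = J₄(α, β) ^ n := by
  induction n with
  | zero => rw [pow_zero, pow_zero, quarticJacobiSymbol_one hβ]
  | succ n ih => rw [pow_succ, pow_succ, quarticJacobiSymbol_mul hβ, ih]

end

theorem prime_natCast_or_exists_prime_norm_eq {l : ℕ} (hl : l.Prime) (hodd : Odd l) :
    (l % 4 = 3 ∧ Prime (l : GaussianInt)) ∨
      (l % 4 = 1 ∧ ∃ ρ : GaussianInt, Prime ρ ∧ ρ.norm = l) := by
  have := Fact.mk hl
  have hmod : l % 4 = 3 ∨ l % 4 = 1 := by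
    rw [Nat.odd_iff] at hodd
    omega
  refine hmod.imp (fun h => ⟨h, GaussianInt.prime_of_nat_prime_of_mod_four_eq_three l h⟩)
    fun h => ⟨h, ?_⟩
  obtain ⟨a, b, hab⟩ := Nat.Prime.sq_add_sq (p := l) (by omega)
  have hnorm : (⟨a, b⟩ : GaussianInt).norm = l := by
    rw [norm_eq_re_sq_add_im_sq, ← hab]
    push_cast
    rfl
  exact ⟨⟨a, b⟩, prime_of_prime_norm hl hnorm, hnorm⟩

theorem natCast_eq_mul_star_of_norm_eq {ρ : GaussianInt} {l : ℕ} (h : ρ.norm = l) :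
    (l : GaussianInt) = ρ * star ρ := by
  rw [← Zsqrtd.norm_eq_mul_conj, h, Int.cast_natCast]

theorem quarticJacobiSymbol_natCast_of_norm_eq {ρ : GaussianInt} (hρ : Prime ρ) {l : ℕ}
    (h : ρ.norm = l) (α : GaussianInt) :
    J₄(α, l) = quarticResidueSymbol α ρ * quarticResidueSymbol α (star ρ) := by
  rw [natCast_eq_mul_star_of_norm_eq h,
    quarticJacobiSymbol_mul_right α hρ.ne_zero (prime_star hρ).ne_zero,
    quarticJacobiSymbol_prime hρ, quarticJacobiSymbol_prime (prime_star hρ)]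

theorem quarticExponent_natCast {l m : ℕ} (h : l = 4 * m + 3) :
    quarticExponent (l : GaussianInt) = (l - 1) * (m + 1) := by
  have hnorm : (l : GaussianInt).norm.natAbs = 4 * ((l - 1) * (m + 1)) + 1 := by
    rw [Zsqrtd.norm_natCast, Int.natAbs_mul, Int.natAbs_natCast, h,
      show 4 * m + 3 - 1 = 4 * m + 2 by omega]
    ring
  rw [quarticExponent, hnorm]
  omega

theorem quarticJacobiSymbol_intCast_natCast_prime {l : ℕ} (hl : l.Prime) (hodd : Odd l) {m : ℤ}
    (h : IsCoprime m l) : J₄((m : GaussianInt), l) = 1 := by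
  have hcop : IsCoprime (m : GaussianInt) l := by simpa using isCoprime_intCast_intCast h
  rcases prime_natCast_or_exists_prime_norm_eq hl hodd with ⟨hmod, hlprime⟩ | ⟨_, ρ, hρ, hnorm⟩
  · have hfermat : (l : GaussianInt) ∣ (m : GaussianInt) ^ (l - 1) - 1 := by
      have := (Zsqrtd.intCast_dvd_intCast (d := -1) _ _).2
        (Int.ModEq.pow_card_sub_one_eq_one hl h).symm.dvd
      push_cast at this
      exact this
    have hlodd : Odd (l : GaussianInt).norm := by
      simpa using odd_norm_intCast ((Int.odd_coe_nat l).2 hodd)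
    rw [quarticJacobiSymbol_prime hlprime]
    refine quarticResidueSymbol_eq_of_dvd hlprime hlodd (one_pow 4) ?_
    rw [quarticExponent_natCast (m := l / 4) (by omega), pow_mul]
    exact hfermat.trans (sub_one_dvd_pow_sub_one _ _)
  · have hρodd : Odd ρ.norm := by rwa [hnorm, Int.odd_coe_nat]
    have hm : ¬ ρ ∣ (m : GaussianInt) := not_dvd_of_isCoprime hρ
      (hcop.of_isCoprime_of_dvd_right ⟨star ρ, natCast_eq_mul_star_of_norm_eq hnorm⟩)
    have hstar := quarticResidueSymbol_star hρ hρodd (m : GaussianInt)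
    rw [star_intCast] at hstar
    rw [quarticJacobiSymbol_natCast_of_norm_eq hρ hnorm, hstar, mul_comm]
    exact star_mul_self_of_pow_four_eq_one (quarticResidueSymbol_spec hρ hρodd hm).1

theorem quarticJacobiSymbol_intCast_mul_right (α : GaussianInt) {m n : ℤ} (hm : Odd m)
    (hn : Odd n) : J₄(α, ((m * n : ℤ) : GaussianInt)) = J₄(α, m.natAbs) * J₄(α, n) := by
  rw [Int.cast_mul, quarticJacobiSymbol_mul_right α (ne_zero_of_odd_norm (odd_norm_intCast hm))
    (ne_zero_of_odd_norm (odd_norm_intCast hn)),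
    quarticJacobiSymbol_associated (associated_intCast_natAbs m)]

theorem quarticJacobiSymbol_intCast_intCast {m n : ℤ} (hn : Odd n) (h : IsCoprime m n) :
    J₄((m : GaussianInt), n) = 1 := by
  refine odd_int_induction (P := fun n => IsCoprime m n → J₄((m : GaussianInt), n) = 1)
    (fun u hu _ => ?_) (fun l n hl hlodd hn ih h => ?_) hn h
  · exact quarticJacobiSymbol_isUnit (isUnit_intCast hu) _
  · have hml : IsCoprime m (l.natAbs : ℤ) :=
      h.of_mul_right_left.of_isCoprime_of_dvd_right (Int.natAbs_dvd.2 dvd_rfl)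
    rw [quarticJacobiSymbol_intCast_mul_right _ hlodd hn, ih h.of_mul_right_right, mul_one]
    exact quarticJacobiSymbol_intCast_natCast_prime hl (Int.natAbs_odd.2 hlodd) hml

/-! ### Gauss and Jacobi sums -/

section GaussSum

variable {F K : Type*} [Field F] [Field K] {χ : MulChar F K} {ψ : AddChar F K}

theorem apply_neg_one_sq (χ : MulChar F K) : χ (-1) ^ 2 = 1 := by
  rw [← map_pow, neg_one_sq, map_one]

theorem isQuadratic_sq_of_pow_four_eq_one (h : χ ^ 4 = 1) : (χ ^ 2).IsQuadratic := by
  intro a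
  by_cases ha : IsUnit a
  · right
    have hpow : χ a ^ 4 = 1 := by
      rw [← MulChar.pow_apply' χ four_ne_zero, h, MulChar.one_apply ha]
    rw [MulChar.pow_apply' χ two_ne_zero, ← sq_eq_one_iff, ← pow_mul, hpow]
  · exact Or.inl (MulChar.map_nonunit _ ha)

variable [Fintype F]

theorem gaussSum_pow_four (h4 : χ ^ 4 = 1) (h2 : χ ^ 2 ≠ 1) (hψ : ψ.IsPrimitive) :
    gaussSum χ ψ ^ 4 = jacobiSum χ χ ^ 2 * Fintype.card F := by
  have hjacobi := jacobiSum_mul_nontrivial (χ := χ) (φ := χ) (by rwa [← sq]) ψ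
  have hsq := gaussSum_sq h2 (isQuadratic_sq_of_pow_four_eq_one h4) hψ
  rw [MulChar.pow_apply' χ two_ne_zero, apply_neg_one_sq, one_mul] at hsq
  rw [← sq, ← sq] at hjacobi
  calc gaussSum χ ψ ^ 4 = (gaussSum χ ψ ^ 2) ^ 2 := by rw [← pow_mul]
    _ = jacobiSum χ χ ^ 2 * gaussSum (χ ^ 2) ψ ^ 2 := by rw [← hjacobi]; ring
    _ = jacobiSum χ χ ^ 2 * Fintype.card F := by rw [hsq]

theorem gaussSum_mul_gaussSum_inv (hχ : χ ≠ 1) (hψ : ψ.IsPrimitive) :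
    gaussSum χ ψ * gaussSum χ⁻¹ ψ = χ (-1) * Fintype.card F := by
  rw [← gaussSum_mul_gaussSum_eq_card hχ hψ, ← mul_gaussSum_inv_eq_gaussSum χ⁻¹ ψ]
  have hinv : χ⁻¹ (-1) = χ (-1) := by
    rw [MulChar.inv_apply', inv_neg, inv_one]
  rw [hinv]
  ring

theorem apply_mul_gaussSum_pow_char {l : ℕ} [Fact l.Prime] [CharP K l] (hl : (l : F) ≠ 0)
    (χ : MulChar F K) (ψ : AddChar F K) :
    (χ ^ l) l * gaussSum χ ψ ^ l = gaussSum (χ ^ l) ψ := by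
  rw [gaussSum_frob, AddChar.pow_mulShift]
  exact gaussSum_mulShift (χ ^ l) ψ (Units.mk0 (l : F) hl)

end GaussSum

theorem isPrimitiveRoot_I : IsPrimitiveRoot I 4 := by
  refine IsPrimitiveRoot.mk_of_lt _ (by norm_num) I_pow_four fun l h0 h4 => ?_
  interval_cases l <;> decide

namespace IsResidueField

variable {F : Type*} [Field F] [Fintype F] {φ : GaussianInt →+* F} {π : GaussianInt}

/-- The quartic residue symbol modulo `π` as a multiplicative character of the residue field
of `π`. -/
noncomputable def quarticChar (hφ : IsResidueField φ π) (hodd : Odd π.norm) :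
    MulChar F GaussianInt where
  toFun a := quarticResidueSymbol (Function.surjInv hφ.surjective a) π
  map_one' := by
    refine quarticResidueSymbol_eq_of_dvd hφ.prime hodd (one_pow 4) ?_
    rw [← hφ.map_eq_iff, map_pow, Function.surjInv_eq hφ.surjective, one_pow, map_one]
  map_mul' a b := by
    rw [← quarticResidueSymbol_mul hφ.prime hodd]
    refine quarticResidueSymbol_congr hφ.prime hodd ?_
    simp only [← hφ.map_eq_iff, map_mul, Function.surjInv_eq hφ.surjective]
  map_nonunit' a ha := by
    refine quarticResidueSymbol_of_dvd ?_
    rw [← hφ.map_eq_zero_iff, Function.surjInv_eq hφ.surjective]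
    simpa using ha

variable (hφ : IsResidueField φ π) (hodd : Odd π.norm)

theorem quarticChar_apply (α : GaussianInt) :
    hφ.quarticChar hodd (φ α) = quarticResidueSymbol α π := by
  refine quarticResidueSymbol_congr hφ.prime hodd ?_
  rw [← hφ.map_eq_iff, Function.surjInv_eq hφ.surjective]

theorem map_quarticChar (a : F) : φ (hφ.quarticChar hodd a) = a ^ quarticExponent π := by
  obtain ⟨α, rfl⟩ := hφ.surjective a
  rw [quarticChar_apply,
    map_pow_quarticExponent hφ.prime hodd ((hφ.map_eq_zero_iff π).2 dvd_rfl)]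

theorem quarticChar_pow_four : hφ.quarticChar hodd ^ 4 = 1 := by
  refine MulChar.ext fun a => ?_
  obtain ⟨α, hα⟩ := hφ.surjective a
  have hπα : ¬ π ∣ α := by
    rw [← hφ.map_eq_zero_iff, hα]
    exact a.ne_zero
  rw [MulChar.pow_apply_coe, MulChar.one_apply_coe, ← hα, quarticChar_apply,
    (quarticResidueSymbol_spec hφ.prime hodd hπα).1]

theorem exists_quarticChar_sq_eq_neg_one : ∃ a : Fˣ, hφ.quarticChar hodd a ^ 2 = -1 := by
  obtain ⟨a, ha⟩ := FiniteField.exists_nonsquare (hφ.ringChar_ne_two hodd)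
  have ha0 : a ≠ 0 := fun h => ha (h ▸ IsSquare.zero)
  refine ⟨Units.mk0 a ha0, ?_⟩
  have hpow : (hφ.quarticChar hodd a ^ 2) ^ 2 = 1 := by
    rw [← pow_mul, ← MulChar.pow_apply' _ four_ne_zero, quarticChar_pow_four,
      MulChar.one_apply (IsUnit.mk0 a ha0)]
  refine (sq_eq_one_iff.1 hpow).resolve_left fun h => ha ?_
  rw [FiniteField.isSquare_iff (hφ.ringChar_ne_two hodd) ha0,
    show Fintype.card F / 2 = quarticExponent π * 2 by
      rw [hφ.card_eq_four_mul_add_one hodd]; omega,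
    pow_mul, ← map_quarticChar hφ hodd, ← map_pow, h, map_one]

theorem quarticChar_comp_pow_four {K : Type*} [CommRing K] (θ : GaussianInt →+* K) :
    (hφ.quarticChar hodd).ringHomComp θ ^ 4 = 1 := by
  rw [MulChar.ringHomComp_pow, quarticChar_pow_four, MulChar.ringHomComp_one]

theorem quarticChar_comp_sq_ne_one {K : Type*} [CommRing K] (θ : GaussianInt →+* K)
    (h2 : (2 : K) ≠ 0) : (hφ.quarticChar hodd).ringHomComp θ ^ 2 ≠ 1 := by
  intro h
  obtain ⟨a, ha⟩ := hφ.exists_quarticChar_sq_eq_neg_one hodd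
  have hone := congrArg (fun χ : MulChar F K => χ a) h
  simp only [MulChar.pow_apply_coe, MulChar.one_apply_coe, MulChar.ringHomComp_apply] at hone
  rw [← map_pow, ha, map_neg, map_one] at hone
  exact h2 (by linear_combination -hone)

theorem quarticChar_comp_ne_one {K : Type*} [CommRing K] (θ : GaussianInt →+* K)
    (h2 : (2 : K) ≠ 0) : (hφ.quarticChar hodd).ringHomComp θ ≠ 1 := fun h =>
  hφ.quarticChar_comp_sq_ne_one hodd θ h2 (by rw [h, one_pow])

/-- The Jacobi sum `J(χ, χ)` of the quartic character `χ` modulo `π`. -/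
noncomputable def quarticJacobiSum (hφ : IsResidueField φ π) (hodd : Odd π.norm) : GaussianInt :=
  jacobiSum (hφ.quarticChar hodd) (hφ.quarticChar hodd)

-- Modulo `π` the sum becomes `∑ x, (x (1 - x)) ^ n` with `4 n = N π - 1`, a polynomial of degree
-- less than `N π - 1`.
theorem dvd_quarticJacobiSum : π ∣ hφ.quarticJacobiSum hodd := by
  rw [← hφ.map_eq_zero_iff, quarticJacobiSum, jacobiSum, map_sum]
  simp only [map_mul, map_quarticChar]
  set n := quarticExponent π
  have hexpand (a : F) : a ^ n * (1 - a) ^ n =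
      ∑ j ∈ Finset.range (n + 1), ((-1) ^ j * (n.choose j : F)) * a ^ (n + j) := by
    rw [sub_eq_neg_add, add_pow, Finset.mul_sum]
    refine Finset.sum_congr rfl fun j _ => ?_
    rw [neg_pow, one_pow]
    ring
  simp only [hexpand]
  rw [Finset.sum_comm]
  refine Finset.sum_eq_zero fun j hj => ?_
  have hsum : ∑ a : F, a ^ (n + j) = 0 := by
    refine FiniteField.sum_pow_lt_card_sub_one F _ ?_
    have := quarticExponent_ne_zero hφ.prime hodd
    rw [hφ.card_eq_four_mul_add_one hodd]
    have := Finset.mem_range.1 hj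
    omega
  rw [← Finset.mul_sum, hsum, mul_zero]

theorem norm_quarticJacobiSum : (hφ.quarticJacobiSum hodd).norm = π.norm := by
  set χ := (hφ.quarticChar hodd).ringHomComp GaussianInt.toComplex with hχ
  have hmap : jacobiSum χ χ = GaussianInt.toComplex (hφ.quarticJacobiSum hodd) :=
    jacobiSum_ringHomComp _ _ _
  have hchar : ringChar ℂ ≠ ringChar F := by
    rw [ringChar.eq_zero]
    exact (CharP.ringChar_ne_zero_of_finite F).symm
  have hχ1 := hφ.quarticChar_comp_ne_one hodd GaussianInt.toComplex two_ne_zero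
  have hχ2 := hφ.quarticChar_comp_sq_ne_one hodd GaussianInt.toComplex two_ne_zero
  have hmul := jacobiSum_mul_jacobiSum_inv hchar hχ1 hχ1 (by rwa [← sq])
  have hstar : jacobiSum χ⁻¹ χ⁻¹ = star (jacobiSum χ χ) := by
    simp only [jacobiSum, star_sum, star_mul', MulChar.star_apply']
  rw [← hχ, hstar, hmap, hφ.card_eq] at hmul
  have hnorm : (((hφ.quarticJacobiSum hodd).norm : ℤ) : GaussianInt) = (π.norm : ℤ) := by
    apply GaussianInt.toComplex_injective
    rw [Zsqrtd.norm_eq_mul_conj, map_mul, GaussianInt.toComplex_star, map_intCast]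
    exact hmul.trans (GaussianInt.natCast_natAbs_norm π)
  exact_mod_cast hnorm

theorem isSemiprimary_quarticJacobiSum : IsSemiprimary (hφ.quarticJacobiSum hodd) := by
  obtain ⟨z, -, hz⟩ := exists_jacobiSum_eq_neg_one_add (by norm_num : 2 < 4)
    (hφ.quarticChar_pow_four hodd) (hφ.quarticChar_pow_four hodd)
    (by rw [hφ.card_eq_four_mul_add_one hodd, Nat.add_sub_cancel]; exact dvd_mul_right 4 _)
    isPrimitiveRoot_I
  rw [quarticJacobiSum, hz, show (I - 1) ^ 2 = ⟨0, -2⟩ by decide]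
  constructor
  · exact ⟨z.im - 1, by simp; ring⟩
  · exact ⟨-z.re, by simp; ring⟩

theorem quarticJacobiSum_sq (hπ : IsSemiprimary π) :
    hφ.quarticJacobiSum hπ.odd_norm ^ 2 = π ^ 2 := by
  have hodd := hπ.odd_norm
  have hassoc : Associated π (hφ.quarticJacobiSum hodd) := by
    obtain ⟨u, hu⟩ := hφ.dvd_quarticJacobiSum hodd
    have hnorm := hφ.norm_quarticJacobiSum hodd
    rw [hu, Zsqrtd.norm_mul] at hnorm
    have hπ0 : π.norm ≠ 0 := GaussianInt.norm_eq_zero.not.2 hφ.prime.ne_zero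
    have hu1 := (mul_eq_left₀ hπ0).1 hnorm
    rw [hu]
    exact associated_mul_unit_right π u ((Zsqrtd.norm_eq_one_iff' (by norm_num) u).1 hu1)
  exact sq_eq_sq_iff_eq_or_eq_neg.2
    (hπ.eq_or_eq_neg_of_associated (hφ.isSemiprimary_quarticJacobiSum hodd) hassoc)

theorem map_natCast_card {K : Type*} [CommRing K] (hφ : IsResidueField φ π)
    (θ : GaussianInt →+* K) : (Fintype.card F : K) = θ π * θ (star π) := by
  rw [hφ.card_eq, ← map_mul, ← Zsqrtd.norm_eq_mul_conj, map_intCast,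
    GaussianInt.natCast_natAbs_norm]

theorem quarticGaussSum_pow_four {K : Type*} [Field K] (θ : GaussianInt →+* K) (h2 : (2 : K) ≠ 0)
    (hπ : IsSemiprimary π) {ψ : AddChar F K} (hψ : ψ.IsPrimitive) :
    gaussSum ((hφ.quarticChar hπ.odd_norm).ringHomComp θ) ψ ^ 4 = θ π ^ 3 * θ (star π) := by
  rw [gaussSum_pow_four (hφ.quarticChar_comp_pow_four _ θ)
    (hφ.quarticChar_comp_sq_ne_one _ θ h2) hψ, jacobiSum_ringHomComp, ← map_pow, ← quarticJacobiSum,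
    quarticJacobiSum_sq hφ hπ, hφ.map_natCast_card θ, map_pow]
  ring

omit [Fintype F] in
theorem exists_primitive_addChar [Finite F] (hφ : IsResidueField φ π) {ρ : GaussianInt}
    (hρ : Prime ρ) {l : ℕ} (hl : l.Prime) (hρl : ρ ∣ (l : GaussianInt))
    (hπl : ¬ π ∣ (l : GaussianInt)) :
    ∃ (K : Type) (_ : Field K) (_ : CharP K l) (θ : GaussianInt →+* K) (ψ : AddChar F K),
      ψ.IsPrimitive ∧ ∀ α, θ α = 0 ↔ ρ ∣ α := by
  obtain ⟨G, _, _, φG, hG⟩ := exists_isResidueField hρ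
  have hringChar : ringChar G = l := by
    have hlG : (l : G) = 0 := by rwa [← map_natCast φG, hG.map_eq_zero_iff]
    exact ((Nat.dvd_prime hl).1 (ringChar.dvd hlG)).resolve_left CharP.ringChar_ne_one
  have hne : ringChar G ≠ ringChar F := by
    intro h
    apply hπl
    rw [← hφ.map_eq_zero_iff, map_natCast, ← hringChar, h]
    exact ringChar.Nat.cast_ringChar
  have : CharP G l := hringChar ▸ ringChar.charP G
  let ψ := AddChar.FiniteField.primitiveChar F G hne
  have hinj : Function.Injective (algebraMap G (CyclotomicField ψ.n G)) := RingHom.injective _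
  refine ⟨CyclotomicField ψ.n G, inferInstance, charP_of_injective_algebraMap hinj l,
    (algebraMap G _).comp φG, ψ.char, ψ.prim, fun α => ?_⟩
  rw [RingHom.comp_apply, _root_.map_eq_zero_iff _ hinj, hG.map_eq_zero_iff]

end IsResidueField

/-! ### Quartic reciprocity -/

namespace IsResidueField

variable {F K : Type*} [Field F] [Fintype F] [Field K] {φ : GaussianInt →+* F} {π : GaussianInt}
  (hφ : IsResidueField φ π) (hodd : Odd π.norm) (θ : GaussianInt →+* K) {l : ℕ} [Fact l.Prime]
  [CharP K l]

theorem quarticGaussSum_pow_of_mod_four_eq_one (hmod : l % 4 = 1)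
    (hπl : ¬ π ∣ (l : GaussianInt)) (ψ : AddChar F K) :
    θ (quarticResidueSymbol l π) * gaussSum ((hφ.quarticChar hodd).ringHomComp θ) ψ ^ l =
      gaussSum ((hφ.quarticChar hodd).ringHomComp θ) ψ := by
  have hl : (l : F) ≠ 0 := by rwa [← map_natCast φ, Ne, hφ.map_eq_zero_iff]
  have hfrob := apply_mul_gaussSum_pow_char hl ((hφ.quarticChar hodd).ringHomComp θ) ψ
  rwa [pow_eq_pow_mod l (hφ.quarticChar_comp_pow_four hodd θ), hmod, pow_one,
    MulChar.ringHomComp_apply, ← map_natCast φ, quarticChar_apply] at hfrob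

theorem quarticGaussSum_pow_of_mod_four_eq_three (h2 : (2 : K) ≠ 0) (hmod : l % 4 = 3)
    (hπl : ¬ π ∣ (l : GaussianInt)) {ψ : AddChar F K} (hψ : ψ.IsPrimitive) :
    gaussSum ((hφ.quarticChar hodd).ringHomComp θ) ψ ^ (l + 1) =
      θ (quarticResidueSymbol (-l) π) * (θ π * θ (star π)) := by
  set χ := (hφ.quarticChar hodd).ringHomComp θ with hχ
  have hχ4 : χ ^ 4 = 1 := hφ.quarticChar_comp_pow_four hodd θ
  have hχl : χ ^ l = χ⁻¹ := by
    rw [pow_eq_pow_mod l hχ4, hmod, eq_inv_iff_mul_eq_one, ← pow_succ, hχ4]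
  have hl : (l : F) ≠ 0 := by rwa [← map_natCast φ, Ne, hφ.map_eq_zero_iff]
  have hfrob := apply_mul_gaussSum_pow_char hl χ ψ
  have hinv : χ l * χ⁻¹ l = 1 := by
    rw [← MulChar.mul_apply, mul_inv_cancel, MulChar.one_apply (IsUnit.mk0 _ hl)]
  have hneg : θ (quarticResidueSymbol (-l) π) = χ (-1) * χ l := by
    rw [← map_mul, neg_one_mul, hχ, MulChar.ringHomComp_apply, ← map_natCast φ, ← map_neg,
      quarticChar_apply]
  have hmul := gaussSum_mul_gaussSum_inv (hφ.quarticChar_comp_ne_one hodd θ h2) hψ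
  rw [hφ.map_natCast_card θ, ← hχ] at hmul
  rw [hχl] at hfrob
  calc gaussSum χ ψ ^ (l + 1) = χ l * (χ⁻¹ l * gaussSum χ ψ ^ l) * gaussSum χ ψ := by
        rw [← mul_assoc, hinv, one_mul, pow_succ]
    _ = χ l * (gaussSum χ ψ * gaussSum χ⁻¹ ψ) := by rw [hfrob]; ring
    _ = θ (quarticResidueSymbol (-l) π) * (θ π * θ (star π)) := by rw [hmul, hneg]; ring

end IsResidueField

theorem map_star_eq_pow {R : Type*} [CommRing R] {l : ℕ} [Fact l.Prime] [CharP R l]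
    (hmod : l % 4 = 3) (θ : GaussianInt →+* R) (α : GaussianInt) : θ (star α) = θ α ^ l := by
  have hint (n : ℤ) : (n : R) ^ l = n := by rw [← frobenius_def, map_intCast]
  have hI : I ^ l = -I := by
    rw [pow_eq_pow_mod l I_pow_four, hmod]
    decide
  have hα : α = α.re + α.im * I := by ext <;> simp [I]
  have hstar : star α = α.re + α.im * -I := by ext <;> simp [I]
  conv_rhs => rw [hα]
  rw [hstar, ← hI]
  simp only [map_add, map_mul, map_intCast, map_pow]
  rw [add_pow_char, mul_pow, hint, hint]

theorem not_dvd_of_dvd_of_not_dvd {π ρ α : GaussianInt} (hπ : Prime π) (hρ : Prime ρ)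
    (hρα : ρ ∣ α) (hπα : ¬ π ∣ α) : ¬ ρ ∣ π := fun h =>
  hπα ((hρ.associated_of_dvd hπ h).dvd_iff_dvd_left.1 hρα)

section Prime

variable {π : GaussianInt} (hπ : Prime π) (hs : IsSemiprimary π) {l : ℕ} [Fact l.Prime]
  (hπl : ¬ π ∣ (l : GaussianInt))

include hπ hs hπl

-- In characteristic `l` the Frobenius acts on `ℤ[i]` as conjugation, so the quartic Gauss sum `g`
-- satisfies `g ^ (l + 1) = (g ^ 4) ^ ((l + 1) / 4) = π ^ ((l + 3) (l + 1) / 4)`.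
theorem quarticResidueSymbol_natCast_of_mod_four_eq_three (hmod : l % 4 = 3) :
    quarticResidueSymbol π l = quarticResidueSymbol (-l) π := by
  have hl : Prime (l : GaussianInt) :=
    GaussianInt.prime_of_nat_prime_of_mod_four_eq_three l hmod
  have hlodd : Odd (l : GaussianInt).norm := by
    simpa using odd_norm_intCast (n := l) ((Int.odd_coe_nat l).2 (Nat.odd_iff.2 (by omega)))
  obtain ⟨m, hm⟩ : ∃ m, l = 4 * m + 3 := ⟨l / 4, by omega⟩
  obtain ⟨F, _, _, φ, hφ⟩ := exists_isResidueField hπ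
  obtain ⟨K, _, _, θ, ψ, hψ, hker⟩ := hφ.exists_primitive_addChar hl Fact.out dvd_rfl hπl
  have h2 : (2 : K) ≠ 0 := fun h => not_dvd_two hl hlodd ((hker 2).1 (by rwa [map_ofNat]))
  have hlπ : ¬ (l : GaussianInt) ∣ π := not_dvd_of_dvd_of_not_dvd hπ hl dvd_rfl hπl
  have hθπ : θ π ≠ 0 := by rwa [Ne, hker]
  have hgauss := hφ.quarticGaussSum_pow_of_mod_four_eq_three hs.odd_norm θ h2 hmod hπl hψ
  rw [show l + 1 = 4 * (m + 1) by omega, pow_mul, hφ.quarticGaussSum_pow_four θ h2 hs hψ,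
    map_star_eq_pow hmod] at hgauss
  have hsplit : (θ π ^ 3 * θ π ^ l) ^ (m + 1) =
      θ π ^ ((l - 1) * (m + 1)) * (θ π * θ π ^ l) := by
    rw [← pow_succ', ← pow_add, ← pow_mul, ← pow_add, hm, Nat.add_sub_assoc (by norm_num)]
    congr 1
    ring
  rw [hsplit, mul_left_inj' (mul_ne_zero hθπ (pow_ne_zero _ hθπ)), ← quarticExponent_natCast hm,
    map_pow_quarticExponent hl hlodd ((hker _).2 dvd_rfl)] at hgauss
  refine eq_of_pow_four_eq_one_of_dvd_sub hl hlodd (quarticResidueSymbol_spec hl hlodd hlπ).1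
    (quarticResidueSymbol_spec hπ hs.odd_norm (by rwa [dvd_neg])).1 ?_
  rw [← hker, map_sub, hgauss, sub_self]

-- Frobenius now acts trivially on `ℤ[i] / ρ`, so `g ^ (l - 1) = (π ^ 3 * star π) ^ ((l - 1) / 4)`
-- is the quartic residue of `π ^ 3 * star π` modulo `ρ`.
theorem quarticResidueSymbol_natCast_mul_eq_one (hmod : l % 4 = 1) {ρ : GaussianInt}
    (hρ : Prime ρ) (hnorm : ρ.norm = l) :
    quarticResidueSymbol l π *
      (quarticResidueSymbol π ρ ^ 3 * quarticResidueSymbol (star π) ρ) = 1 := by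
  have hlρ := natCast_eq_mul_star_of_norm_eq hnorm
  have hρl : ρ ∣ (l : GaussianInt) := Dvd.intro _ hlρ.symm
  have hρodd : Odd ρ.norm := by
    rw [hnorm, Int.odd_coe_nat, Nat.odd_iff]
    omega
  obtain ⟨F, _, _, φ, hφ⟩ := exists_isResidueField hπ
  obtain ⟨K, _, _, θ, ψ, hψ, hker⟩ := hφ.exists_primitive_addChar hρ Fact.out hρl hπl
  have h2 : (2 : K) ≠ 0 := fun h => not_dvd_two hρ hρodd ((hker 2).1 (by rwa [map_ofNat]))
  have hρπ : ¬ ρ ∣ π := not_dvd_of_dvd_of_not_dvd hπ hρ hρl hπl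
  have hρstarπ : ¬ ρ ∣ star π :=
    not_dvd_of_dvd_of_not_dvd (prime_star hπ) hρ hρl
      fun h => hπl (by simpa using star_dvd_star h)
  have hgauss := hφ.quarticGaussSum_pow_of_mod_four_eq_one hs.odd_norm θ hmod hπl ψ
  have hg4 := hφ.quarticGaussSum_pow_four θ h2 hs hψ
  set g := gaussSum ((hφ.quarticChar hs.odd_norm).ringHomComp θ) ψ
  have hg : g ≠ 0 := by
    rw [← pow_ne_zero_iff four_ne_zero, hg4]
    exact mul_ne_zero (pow_ne_zero 3 (by rwa [Ne, hker])) (by rwa [Ne, hker])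
  have hl : l = 4 * quarticExponent ρ + 1 := by
    simpa [hnorm] using natAbs_norm_eq_four_mul_add_one hρodd
  have hresidue := map_pow_quarticExponent (θ := θ) hρ hρodd ((hker ρ).2 dvd_rfl)
  have hgl : g ^ l = θ (quarticResidueSymbol π ρ ^ 3 * quarticResidueSymbol (star π) ρ) * g := by
    conv_lhs => rw [hl]
    rw [pow_succ, pow_mul, hg4, mul_pow, pow_right_comm, hresidue, hresidue, map_mul, map_pow]
  rw [hgl, ← mul_assoc, ← map_mul, mul_eq_right₀ hg] at hgauss
  have hl4 := (quarticResidueSymbol_spec hπ hs.odd_norm hπl).1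
  have hπ4 := (quarticResidueSymbol_spec hρ hρodd hρπ).1
  have hstarπ4 := (quarticResidueSymbol_spec hρ hρodd hρstarπ).1
  refine eq_of_pow_four_eq_one_of_dvd_sub hρ hρodd ?_ (one_pow 4)
    (by rw [← hker, map_sub, hgauss, map_one, sub_self])
  rw [mul_pow, mul_pow, pow_right_comm, hl4, hπ4, hstarπ4, one_pow, one_mul, one_mul]

theorem quarticResidueSymbol_mul_star_of_mod_four_eq_one (hmod : l % 4 = 1) {ρ : GaussianInt}
    (hρ : Prime ρ) (hnorm : ρ.norm = l) :
    quarticResidueSymbol π ρ * quarticResidueSymbol π (star ρ) = quarticResidueSymbol l π := by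
  have hone := quarticResidueSymbol_natCast_mul_eq_one hπ hs hπl hmod hρ hnorm
  have hlρ := natCast_eq_mul_star_of_norm_eq hnorm
  have hρodd : Odd ρ.norm := by
    rw [hnorm, Int.odd_coe_nat, Nat.odd_iff]
    omega
  have hπ4 := (quarticResidueSymbol_spec hρ hρodd
    (not_dvd_of_dvd_of_not_dvd hπ hρ (Dvd.intro _ hlρ.symm) hπl)).1
  have hstar4 := (quarticResidueSymbol_spec (prime_star hρ) (odd_norm_star hρodd)
    (not_dvd_of_dvd_of_not_dvd hπ (prime_star hρ) (Dvd.intro_left _ hlρ.symm) hπl)).1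
  have hconj := quarticResidueSymbol_star (prime_star hρ) (odd_norm_star hρodd) π
  rw [star_star] at hconj
  rw [hconj] at hone
  set s := quarticResidueSymbol π ρ
  set t := quarticResidueSymbol π (star ρ)
  calc s * t = quarticResidueSymbol l π * (s ^ 3 * star t) * (s * t) := by rw [hone, one_mul]
    _ = quarticResidueSymbol l π * s ^ 4 * (star t * t) := by ring
    _ = quarticResidueSymbol l π := by
      rw [hπ4, star_mul_self_of_pow_four_eq_one hstar4, mul_one, mul_one]

end Prime

/-- The integer `±n` congruent to `1` modulo `4`, for odd `n`; it is `0` for even `n`. The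
reciprocity law takes its simplest form for these integers. -/
def primaryAssociate (n : ℤ) : ℤ := ZMod.χ₄ n * n

theorem primaryAssociate_mul (m n : ℤ) :
    primaryAssociate (m * n) = primaryAssociate m * primaryAssociate n := by
  simp only [primaryAssociate, Int.cast_mul, map_mul]
  ring

theorem primaryAssociate_of_mod_four_eq_one {n : ℤ} (h : n % 4 = 1) : primaryAssociate n = n := by
  rw [primaryAssociate, ZMod.χ₄_int_one_mod_four h, one_mul]

theorem primaryAssociate_of_mod_four_eq_three {n : ℤ} (h : n % 4 = 3) :
    primaryAssociate n = -n := by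
  rw [primaryAssociate, ZMod.χ₄_int_three_mod_four h, neg_one_mul]

theorem primaryAssociate_neg (n : ℤ) : primaryAssociate (-n) = primaryAssociate n := by
  have hneg : ZMod.χ₄ (-n : ZMod 4) = -ZMod.χ₄ n := by
    generalize (n : ZMod 4) = a
    revert a
    decide
  rw [primaryAssociate, primaryAssociate, Int.cast_neg, hneg, neg_mul_neg]

theorem primaryAssociate_natAbs (n : ℤ) : primaryAssociate n.natAbs = primaryAssociate n := by
  rcases Int.natAbs_eq n with h | h
  · rw [← h]
  · conv_rhs => rw [h, primaryAssociate_neg]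

theorem quarticResidueSymbol_primaryAssociate {π : GaussianInt} (hπ : Prime π)
    (hs : IsSemiprimary π) {l : ℕ} (hl : l.Prime) (hodd : Odd l)
    (hπl : ¬ π ∣ (l : GaussianInt)) :
    quarticResidueSymbol (primaryAssociate l : GaussianInt) π = J₄(π, l) := by
  have := Fact.mk hl
  rcases prime_natCast_or_exists_prime_norm_eq hl hodd with ⟨hmod, hlprime⟩ | ⟨hmod, ρ, hρ, hnorm⟩
  · rw [quarticJacobiSymbol_prime hlprime,
      quarticResidueSymbol_natCast_of_mod_four_eq_three hπ hs hπl hmod,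
      primaryAssociate_of_mod_four_eq_three (by omega), Int.cast_neg, Int.cast_natCast]
  · rw [quarticJacobiSymbol_natCast_of_norm_eq hρ hnorm,
      quarticResidueSymbol_mul_star_of_mod_four_eq_one hπ hs hπl hmod hρ hnorm,
      primaryAssociate_of_mod_four_eq_one (by omega), Int.cast_natCast]

theorem quarticJacobiSymbol_primaryAssociate_prime {β : GaussianInt} (hβ : IsSemiprimary β)
    {l : ℕ} (hl : l.Prime) (hodd : Odd l) (h : IsCoprime (l : GaussianInt) β) :
    J₄((primaryAssociate l : GaussianInt), β) = J₄(β, l) := by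
  have hlodd : Odd (l : ℤ) := (Int.odd_coe_nat l).2 hodd
  have hunit (u : ℤ) (hu : IsUnit u) :
      J₄((primaryAssociate l : GaussianInt), u) = J₄((u : GaussianInt), (l : ℤ)) := by
    rw [quarticJacobiSymbol_isUnit (isUnit_intCast hu),
      quarticJacobiSymbol_intCast_intCast hlodd
        (isCoprime_one_left.of_isCoprime_of_dvd_left hu.dvd)]
  refine semiprimary_induction
    (P := fun β => IsCoprime (l : GaussianInt) β → J₄((primaryAssociate l : GaussianInt), β) =
      J₄(β, l)) (fun _ => by simpa using hunit 1 isUnit_one)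
    (fun _ => by simpa using hunit (-1) isUnit_one.neg) (fun π β hπ hπs hβ ih h => ?_) hβ h
  rw [quarticJacobiSymbol_prime_mul hπ hβ.odd_norm,
    quarticJacobiSymbol_mul (by simpa using odd_norm_intCast hlodd), ih h.of_mul_right_right,
    quarticResidueSymbol_primaryAssociate hπ hπs hl hodd
      (not_dvd_of_isCoprime hπ h.of_mul_right_left)]

theorem quarticJacobiSymbol_reciprocity {n : ℤ} (hn : Odd n) {β : GaussianInt}
    (hβ : IsSemiprimary β) (h : IsCoprime (n : GaussianInt) β) :
    J₄((primaryAssociate n : GaussianInt), β) = J₄(β, n) := by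
  refine odd_int_induction
    (P := fun n => IsCoprime (n : GaussianInt) β →
      J₄((primaryAssociate n : GaussianInt), β) = J₄(β, n))
    (fun u hu _ => ?_) (fun l n hl hlodd hn ih h => ?_) hn h
  · rw [quarticJacobiSymbol_isUnit (isUnit_intCast hu)]
    have hone : primaryAssociate u = 1 := by
      rcases Int.isUnit_iff.1 hu with rfl | rfl <;> decide
    rw [hone, Int.cast_one, quarticJacobiSymbol_one hβ.odd_norm]
  · rw [Int.cast_mul] at h
    rw [quarticJacobiSymbol_intCast_mul_right _ hlodd hn, primaryAssociate_mul, Int.cast_mul,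
      quarticJacobiSymbol_mul hβ.odd_norm, ih h.of_mul_left_right, ← primaryAssociate_natAbs l,
      quarticJacobiSymbol_primaryAssociate_prime hβ hl (Int.natAbs_odd.2 hlodd)
        (h.of_mul_left_left.of_isCoprime_of_dvd_left (associated_intCast_natAbs l).symm.dvd)]

/-! ### Supplements to the reciprocity law -/

theorem emod_four_eq_one_or_three {n : ℤ} (hn : Odd n) : n % 4 = 1 ∨ n % 4 = 3 := by
  rw [Int.odd_iff] at hn
  omega

theorem exists_eq_eight_mul_add {n : ℤ} (hn : Odd n) :
    ∃ m r : ℤ, (r = 1 ∨ r = 3 ∨ r = 5 ∨ r = 7) ∧ n = 8 * m + r :=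
  ⟨n / 8, n % 8, by rw [Int.odd_iff] at hn; omega, by omega⟩

theorem chi₈_eq_negOnePow {n : ℤ} (hn : Odd n) :
    ZMod.χ₈ n = (((n ^ 2 - 1) / 8).negOnePow : ℤ) := by
  obtain ⟨m, r, hr, rfl⟩ := exists_eq_eight_mul_add hn
  have hdiv : ((8 * m + r) ^ 2 - 1) / 8 = 2 * (4 * m ^ 2 + m * r) + (r ^ 2 - 1) / 8 := by
    rw [show (8 * m + r) ^ 2 - 1 = r ^ 2 - 1 + 8 * (2 * (4 * m ^ 2 + m * r)) by ring,
      Int.add_mul_ediv_left _ _ (by norm_num), add_comm]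
  rw [hdiv, Int.negOnePow_add, Int.negOnePow_two_mul, one_mul, ZMod.χ₈_int_eq_if_mod_eight,
    Int.mul_add_emod_self_left]
  rw [show (8 * m + r) % 2 = r % 2 by omega]
  rcases hr with rfl | rfl | rfl | rfl <;> decide

theorem chi₄_mul_chi₈_eq_negOnePow {n : ℤ} (hn : Odd n) :
    ZMod.χ₄ n * ZMod.χ₈ n = ((n / 4).negOnePow : ℤ) := by
  obtain ⟨m, r, hr, rfl⟩ := exists_eq_eight_mul_add hn
  rw [show (8 * m + r) / 4 = 2 * m + r / 4 by omega, Int.negOnePow_add, Int.negOnePow_two_mul,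
    one_mul, ZMod.χ₄_int_eq_if_mod_four, ZMod.χ₈_int_eq_if_mod_eight, Int.mul_add_emod_self_left]
  have h2 : (8 * m + r) % 2 = r % 2 := by omega
  have h4 : (8 * m + r) % 4 = r % 4 := by omega
  rw [h2, h4]
  rcases hr with rfl | rfl | rfl | rfl <;> decide

theorem chi₄_mul_self {n : ℤ} (hn : Odd n) : ZMod.χ₄ n * ZMod.χ₄ n = 1 := by
  rcases emod_four_eq_one_or_three hn with h | h
  · rw [ZMod.χ₄_int_one_mod_four h, one_mul]
  · rw [ZMod.χ₄_int_three_mod_four h, neg_one_mul, neg_neg]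

theorem chi₈_mul_self {n : ℤ} (hn : Odd n) : ZMod.χ₈ n * ZMod.χ₈ n = 1 := by
  rw [chi₈_eq_negOnePow hn, ← Units.val_mul, Int.units_mul_self, Units.val_one]

theorem I_pow_two_mul (n : ℕ) : I ^ (2 * n) = (((n : ℤ).negOnePow : ℤ) : GaussianInt) := by
  rw [Int.cast_negOnePow_natCast, pow_mul, sq, I_mul_I]

theorem quarticJacobiSymbol_I_of_odd_re {a : ℤ} (ha : Odd a) (b : ℤ) :
    J₄(I, ⟨a, 2 * b⟩) = ZMod.χ₈ a * I ^ (b.natAbs ^ 2) := by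
  have hs : IsSemiprimary ⟨a, 2 * b⟩ := ⟨ha, even_two_mul b⟩
  have hdiv : (a ^ 2 - 1) / 8 * 8 = a ^ 2 - 1 :=
    Int.ediv_mul_cancel (Int.eight_dvd_sq_sub_one_of_odd ha)
  obtain ⟨t, ht⟩ := Int.eq_ofNat_of_zero_le (a := (a ^ 2 - 1) / 8) (by
    have := sq_nonneg a
    omega)
  have hexp : quarticExponent ⟨a, 2 * b⟩ = 2 * t + b.natAbs ^ 2 := by
    have hnorm : (⟨a, 2 * b⟩ : GaussianInt).norm = 4 * (2 * t + b.natAbs ^ 2 : ℕ) + 1 := by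
      rw [norm_eq_re_sq_add_im_sq]
      push_cast
      rw [sq_abs]
      linarith
    have hnat := natAbs_norm_eq_four_mul_add_one hs.odd_norm
    rw [hnorm] at hnat
    omega
  rw [quarticJacobiSymbol_I hs.odd_norm, hexp, pow_add, I_pow_two_mul, ← ht, chi₈_eq_negOnePow ha]

theorem quarticJacobiSymbol_I_intCast {n : ℤ} (hn : Odd n) :
    J₄(I, (n : GaussianInt)) = ZMod.χ₈ n := by
  have := quarticJacobiSymbol_I_of_odd_re hn 0
  rwa [mul_zero, ← Zsqrtd.intCast_val, Int.natAbs_zero, sq, mul_zero, pow_zero, mul_one] at this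

theorem quarticJacobiSymbol_I_of_odd {a b : ℤ} (ha : Odd a) (hb : Odd b) :
    J₄(I, ⟨a, 2 * b⟩) = ZMod.χ₈ a * I := by
  obtain ⟨m, hm⟩ := (Int.natAbs_odd.2 hb)
  have hpow : I ^ (b.natAbs ^ 2) = I := by
    rw [hm, show (2 * m + 1) ^ 2 = 4 * (m ^ 2 + m) + 1 by ring, pow_succ, pow_mul, I_pow_four,
      one_pow, one_mul]
  rw [quarticJacobiSymbol_I_of_odd_re ha, hpow]

theorem quarticJacobiSymbol_neg_one {a : ℤ} (ha : Odd a) (b : ℤ) :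
    J₄(-1, ⟨a, 2 * b⟩) = (b.negOnePow : ℤ) := by
  have hs : IsSemiprimary ⟨a, 2 * b⟩ := ⟨ha, even_two_mul b⟩
  have hsq : ((b.natAbs ^ 2 : ℕ) : ℤ).negOnePow = b.negOnePow := by
    rw [Nat.cast_pow, Int.natAbs_sq, sq, Int.negOnePow_mul_self]
  rw [← I_mul_I, quarticJacobiSymbol_mul hs.odd_norm, quarticJacobiSymbol_I_of_odd_re ha,
    mul_mul_mul_comm, ← Int.cast_mul, chi₈_mul_self ha, Int.cast_one, one_mul, ← pow_add, ← two_mul,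
    I_pow_two_mul, hsq]

theorem primaryAssociate_sq {n : ℤ} (hn : Odd n) : primaryAssociate n ^ 2 = n ^ 2 := by
  rw [primaryAssociate, mul_pow, sq (ZMod.χ₄ _), chi₄_mul_self hn, one_mul]

theorem quarticJacobiSymbol_primaryAssociate_sq {β : GaussianInt} (hβ : Odd β.norm) {n : ℤ}
    (hn : Odd n) :
    J₄((primaryAssociate n : GaussianInt), β) ^ 2 = J₄((n : GaussianInt), β) ^ 2 := by
  rw [← quarticJacobiSymbol_pow hβ, ← quarticJacobiSymbol_pow hβ, ← Int.cast_pow,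
    primaryAssociate_sq hn, Int.cast_pow]

theorem quarticJacobiSymbol_primaryAssociate_of_neg_one {β : GaussianInt} (hβ : Odd β.norm)
    (h : J₄(-1, β) = -1) {n : ℤ} (hn : Odd n) :
    J₄((primaryAssociate n : GaussianInt), β) = ZMod.χ₄ n * J₄((n : GaussianInt), β) := by
  rcases emod_four_eq_one_or_three hn with hmod | hmod
  · rw [primaryAssociate_of_mod_four_eq_one hmod, ZMod.χ₄_int_one_mod_four hmod, Int.cast_one,
      one_mul]
  · rw [primaryAssociate_of_mod_four_eq_three hmod, ZMod.χ₄_int_three_mod_four hmod, Int.cast_neg,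
      Int.cast_neg, Int.cast_one, neg_one_mul, ← neg_one_mul (n : GaussianInt),
      quarticJacobiSymbol_mul hβ, h, neg_one_mul]

theorem quarticJacobiSymbol_primaryAssociate_of_one {β : GaussianInt} (hβ : Odd β.norm)
    (h : J₄(-1, β) = 1) {n : ℤ} (hn : Odd n) :
    J₄((primaryAssociate n : GaussianInt), β) = J₄((n : GaussianInt), β) := by
  rcases emod_four_eq_one_or_three hn with hmod | hmod
  · rw [primaryAssociate_of_mod_four_eq_one hmod]
  · rw [primaryAssociate_of_mod_four_eq_three hmod, Int.cast_neg, ← neg_one_mul,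
      quarticJacobiSymbol_mul hβ, h, one_mul]

section Semiprimary

variable {β : GaussianInt} (hβ : IsSemiprimary β) (hcop : IsCoprime β.re β.im)

include hβ hcop

theorem quarticJacobiSymbol_primaryAssociate_re :
    J₄((primaryAssociate β.re : GaussianInt), β) = ZMod.χ₈ β.re := by
  have hcopβ : IsCoprime (β.re : GaussianInt) β := by
    refine isCoprime_intCast_of_isCoprime_norm ?_
    rw [norm_eq_re_sq_add_im_sq, sq, add_comm, IsCoprime.add_mul_left_right_iff]
    exact hcop.pow_right
  have hcongr : (β.re : GaussianInt) ∣ β - β.im * I := ⟨1, by ext <;> simp [I]⟩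
  rw [quarticJacobiSymbol_reciprocity hβ.1 hβ hcopβ,
    quarticJacobiSymbol_congr (odd_norm_intCast hβ.1) hcongr,
    quarticJacobiSymbol_mul (odd_norm_intCast hβ.1), quarticJacobiSymbol_intCast_intCast hβ.1
      hcop.symm, quarticJacobiSymbol_I_intCast hβ.1, one_mul]

theorem quarticJacobiSymbol_re_sub_im_sq :
    J₄(((β.re - β.im : ℤ) : GaussianInt), β) ^ 2 = ZMod.χ₈ (β.re - β.im : ℤ) := by
  have hodd : Odd (β.re - β.im) := hβ.1.sub_even hβ.2
  have hre : IsCoprime β.re (β.re - β.im) := by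
    rw [show β.re - β.im = -β.im + β.re * 1 by ring, IsCoprime.add_mul_left_right_iff]
    exact hcop.neg_right
  have hcopβ : IsCoprime ((β.re - β.im : ℤ) : GaussianInt) β := by
    refine isCoprime_intCast_of_isCoprime_norm ?_
    rw [show β.norm = 2 * β.re ^ 2 + (β.re - β.im) * (-(β.re + β.im)) by
      rw [norm_eq_re_sq_add_im_sq]; ring, IsCoprime.add_mul_left_right_iff]
    exact (Int.isCoprime_two_right.2 hodd).mul_right hre.symm.pow_right
  -- `β = a + b i` is `a (1 + i)` modulo `a - b`.
  have hcongr : ((β.re - β.im : ℤ) : GaussianInt) ∣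
      β ^ 2 - ((2 * β.re ^ 2 : ℤ) : GaussianInt) * I := by
    rw [Zsqrtd.intCast_dvd]
    constructor
    · exact ⟨β.re + β.im, by simp [sq, I]; ring⟩
    · exact ⟨-(2 * β.re), by simp [sq, I]; ring⟩
  rw [← quarticJacobiSymbol_primaryAssociate_sq hβ.odd_norm hodd,
    quarticJacobiSymbol_reciprocity hodd hβ hcopβ,
    ← quarticJacobiSymbol_pow (odd_norm_intCast hodd),
    quarticJacobiSymbol_congr (odd_norm_intCast hodd) hcongr,
    quarticJacobiSymbol_mul (odd_norm_intCast hodd), quarticJacobiSymbol_intCast_intCast hodd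
      ((Int.isCoprime_two_left.2 hodd).mul_left hre.pow_left), quarticJacobiSymbol_I_intCast hodd,
    one_mul]

-- Modulo `β = a + b i` one has `b = a i`, so `i (a - b) ^ 2 = 2 a ^ 2`.
theorem quarticJacobiSymbol_two :
    J₄(2, β) = J₄(I, β) * ZMod.χ₈ (β.re - β.im : ℤ) := by
  have hcongr : β ∣ 2 * (β.re : GaussianInt) ^ 2 - I * ((β.re - β.im : ℤ) : GaussianInt) ^ 2 :=
    ⟨⟨2 * β.re - β.im, -β.re⟩, by ext <;> simp [sq, I] <;> ring⟩
  have hre : J₄((β.re : GaussianInt), β) ^ 2 = 1 := by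
    rw [← quarticJacobiSymbol_primaryAssociate_sq hβ.odd_norm hβ.1,
      quarticJacobiSymbol_primaryAssociate_re hβ hcop, sq, ← Int.cast_mul, chi₈_mul_self hβ.1,
      Int.cast_one]
  have := quarticJacobiSymbol_congr hβ.odd_norm hcongr
  rwa [quarticJacobiSymbol_mul hβ.odd_norm, quarticJacobiSymbol_mul hβ.odd_norm,
    quarticJacobiSymbol_pow hβ.odd_norm, quarticJacobiSymbol_pow hβ.odd_norm, hre, mul_one,
    quarticJacobiSymbol_re_sub_im_sq hβ hcop] at this

end Semiprimary

theorem quarticJacobiSymbolRat_div_one {a b n : ℤ} (hb : b ≠ 0) (hab : IsCoprime a b)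
    (hn : Odd n) (hbn : IsCoprime b n) :
    quarticJacobiSymbolRat ((a : ℚ) / b) 1 n = J₄(⟨a, b⟩, n) := by
  obtain ⟨u, hnum, hden⟩ := Rat.exists_eq_mul_div_num_and_eq_mul_div_den a hb
  set r : ℚ := a / b
  have hu : IsUnit u := hab.isUnit_of_dvd' (Dvd.intro _ hnum.symm) (Dvd.intro _ hden.symm)
  have hun : IsCoprime u n := isCoprime_one_left.of_isCoprime_of_dvd_left hu.dvd
  have hdenn : IsCoprime (r.den : ℤ) n := hbn.of_isCoprime_of_dvd_left (Dvd.intro_left _ hden.symm)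
  have hab' : (⟨a, b⟩ : GaussianInt) = u * ⟨r.num, r.den⟩ := by
    conv_lhs => rw [hnum, hden]
    ext <;> simp
  have hsymbol : J₄(((r.den : ℤ) : GaussianInt), n) = 1 :=
    quarticJacobiSymbol_intCast_intCast hn hdenn
  rw [Int.cast_natCast] at hsymbol
  rw [quarticJacobiSymbolRat, Rat.num_one, Rat.den_one, Nat.cast_one, mul_one, one_mul, mul_one,
    hsymbol, star_one, mul_one, hab', quarticJacobiSymbol_mul (odd_norm_intCast hn),
    quarticJacobiSymbol_intCast_intCast hn hun, one_mul]

/-! ### Reduction modulo a prime of degree one -/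

theorem exists_ringHom_map_I_eq_div {K : Type*} [Field K] {c d : ℤ} (hc : (c : K) ≠ 0)
    (h : (c : K) ^ 2 + (d : K) ^ 2 = 0) :
    ∃ φ : GaussianInt →+* K, φ I = d / c ∧ φ ⟨c, d⟩ = 0 := by
  have hsq : (d / c : K) * (d / c) = ((-1 : ℤ) : K) := by
    push_cast
    field_simp
    linear_combination h
  refine ⟨Zsqrtd.lift ⟨d / c, hsq⟩, by simp [I], ?_⟩
  simp only [Zsqrtd.lift_apply_apply]
  field_simp
  linear_combination h

theorem map_quarticJacobiSymbol_intCast {R : Type*} [CommRing R] {φ : GaussianInt →+* R} {p : ℕ}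
    {π : GaussianInt} (hp : p.Prime) (hodd : Odd p) (hnorm : π.norm = p) (hφ : φ π = 0) (n : ℤ) :
    φ J₄((n : GaussianInt), π) = (n : R) ^ ((p - 1) / 4) := by
  have hπ := prime_of_prime_norm hp hnorm
  have hpow := map_pow_quarticExponent hπ (by rwa [hnorm, Int.odd_coe_nat]) hφ n
  rw [quarticJacobiSymbol_prime hπ, ← hpow, map_intCast, quarticExponent, hnorm,
    Int.natAbs_natCast]

theorem map_I_ne_zero {R : Type*} [Semiring R] [Nontrivial R] (φ : GaussianInt →+* R) : φ I ≠ 0 :=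
  ((IsUnit.of_pow_eq_one I_pow_four four_ne_zero).map φ).ne_zero

theorem zpow_eq_pow_toNat_emod_four {K : Type*} [DivisionRing K] {z : K} (hz : z ^ 4 = 1) (k : ℤ) :
    z ^ k = z ^ (k % 4).toNat := by
  have hz0 : z ≠ 0 := fun h0 => by simp [h0] at hz
  have hk : k = (4 : ℕ) * (k / 4) + ((k % 4).toNat : ℕ) := by omega
  conv_lhs => rw [hk, zpow_add₀ hz0, zpow_mul, zpow_natCast, hz, one_zpow, one_mul, zpow_natCast]

theorem map_eq_zpow_of_toComplex_eq {K : Type*} [Field K] (φ : GaussianInt →+* K)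
    {s : GaussianInt} {k : ℤ} (h : s.toComplex = Complex.I ^ k) : φ s = φ I ^ k := by
  have hI : I.toComplex = Complex.I := by simp [I, GaussianInt.toComplex_def]
  have hs : s = I ^ (k % 4).toNat := by
    apply GaussianInt.toComplex_injective
    rw [h, map_pow, hI, zpow_eq_pow_toNat_emod_four Complex.I_pow_four]
  rw [hs, map_pow, zpow_eq_pow_toNat_emod_four (by rw [← map_pow, I_pow_four, map_one])]

theorem sq_dvd_sq_add_mul_sq {R : Type*} [CommRing R] {p q a b : R} (hp : Prime p) (hpq : ¬ p ∣ q)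
    (ha : p ∣ a) (h : p ∣ a ^ 2 + q * b ^ 2) : p ^ 2 ∣ a ^ 2 + q * b ^ 2 := by
  have hb : p ∣ b := by
    rw [dvd_add_right (dvd_pow ha two_ne_zero)] at h
    exact hp.dvd_of_dvd_pow ((hp.dvd_or_dvd h).resolve_left hpq)
  exact dvd_add (pow_dvd_pow_of_dvd ha 2) ((pow_dvd_pow_of_dvd hb 2).mul_left q)

theorem not_dvd_of_eq_sq_add_sq {p c d : ℤ} (hp : Prime p) (h : p = c ^ 2 + d ^ 2) : ¬ p ∣ c := by
  intro hc
  have hsq := sq_dvd_sq_add_mul_sq (b := d) hp hp.not_dvd_one hc (by rw [one_mul, ← h])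
  rw [one_mul, ← h, sq] at hsq
  exact hp.not_isUnit (hp.irreducible.squarefree p hsq)

theorem exists_ringHom_zmod_map_I_eq_div {p : ℕ} [Fact p.Prime] {c d : ℤ}
    (h : (p : ℤ) = c ^ 2 + d ^ 2) :
    ∃ φ : GaussianInt →+* ZMod p, φ I = d / c ∧ φ ⟨c, d⟩ = 0 := by
  have hprime : Prime (p : ℤ) := Nat.prime_iff_prime_int.1 Fact.out
  refine exists_ringHom_map_I_eq_div (fun hc => ?_) ?_
  · exact not_dvd_of_eq_sq_add_sq hprime h ((ZMod.intCast_zmod_eq_zero_iff_dvd c p).1 hc)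
  · exact_mod_cast (ZMod.intCast_zmod_eq_zero_iff_dvd (c ^ 2 + d ^ 2) p).2 (dvd_of_eq h)

theorem odd_of_four_mul_eq {n q x y : ℤ} (hq : Odd q) (hy : Odd y)
    (h : 4 * n = x ^ 2 + q * y ^ 2) : Odd x := by
  have hsq : Odd (x ^ 2) := by
    rw [show x ^ 2 = 4 * n - q * y ^ 2 by linear_combination -h]
    exact (Even.mul_right (by decide) _).sub_odd (hq.mul hy.pow)
  exact (Int.odd_pow.1 hsq).resolve_right two_ne_zero

theorem isCoprime_of_four_mul_eq {p q x y : ℤ} (hp : Prime p) (hpq : ¬ p ∣ q) (hx : Odd x)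
    (h : 4 * p = x ^ 2 + q * y ^ 2) : IsCoprime x (q * y ^ 2) := by
  have hfour : IsCoprime x (2 ^ 2) := (Int.isCoprime_two_right.2 hx).pow_right
  have hpx : ¬ p ∣ x := by
    intro hdvd
    have hsq := sq_dvd_sq_add_mul_sq hp hpq hdvd (h ▸ dvd_mul_left p 4)
    rw [← h, sq, mul_dvd_mul_iff_right hp.ne_zero] at hsq
    exact hp.not_isUnit ((hfour.of_isCoprime_of_dvd_left hdvd).isUnit_of_dvd hsq)
  have hprod := hfour.mul_right ((hp.irreducible.coprime_iff_not_dvd).2 hpx).symm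
  rwa [show (2 : ℤ) ^ 2 * p = q * y ^ 2 + x * x by linear_combination h,
    IsCoprime.add_mul_left_right_iff] at hprod

/-! ### The symbol of `q` in a pair of representations -/

/-- Representations `p = c ^ 2 + d ^ 2` and `4 * p = x ^ 2 + q * y ^ 2` of one integer `p`, with the
signs of `c` and `y` normalized. The integer `p` itself is eliminated. -/
structure RepresentationPair (q c d x y : ℤ) : Prop where
  eq : 4 * (c ^ 2 + d ^ 2) = x ^ 2 + q * y ^ 2
  q_mod : q % 8 = 3
  c_mod : c % 4 = 1
  y_mod : y % 4 = 1
  even_d : Even d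
  isCoprime_c : IsCoprime c (x + 2 * d)
  isCoprime_x : IsCoprime x (q * y ^ 2)

namespace RepresentationPair

variable {q c d x y : ℤ} (h : RepresentationPair q c d x y)

-- `Λ` is, up to the unit `i`, the numerator of `2 c / (x + 2 d) + i`.
local notation "Λ" => (Zsqrtd.mk (x + 2 * d) (2 * -c) : GaussianInt)

theorem of_prime {p : ℤ} (hprime : Prime p) (hp : p % 4 = 1) (hq : q ≡ 3 [ZMOD 8])
    (hpq : ¬ p ∣ q) (hcd : p = c ^ 2 + d ^ 2) (hxy : 4 * p = x ^ 2 + q * y ^ 2)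
    (hc : c ≡ 1 [ZMOD 4]) (hy : y ≡ 1 [ZMOD 4]) (hgcd : Int.gcd c (x + 2 * d) = 1) :
    RepresentationPair q c d x y := by
  have hc' : c % 4 = 1 := hc
  have hy' : y % 4 = 1 := hy
  have hq' : q % 8 = 3 := hq
  have hodd_p : Odd (c ^ 2 + d ^ 2) := by
    rw [← hcd, Int.odd_iff]
    omega
  have hodd_c : Odd (c ^ 2) := (Int.odd_iff.2 (by omega)).pow
  have hodd_x : Odd x :=
    odd_of_four_mul_eq (Int.odd_iff.2 (by omega)) (Int.odd_iff.2 (by omega)) hxy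
  exact
    { eq := hcd ▸ hxy
      q_mod := hq'
      c_mod := hc'
      y_mod := hy'
      even_d := (Int.even_pow.1 ((Int.odd_add.1 hodd_p).1 hodd_c)).1
      isCoprime_c := Int.isCoprime_iff_gcd_eq_one.2 hgcd
      isCoprime_x := isCoprime_of_four_mul_eq hprime hpq hodd_x hxy }

include h

theorem odd_q : Odd q := by
  have := h.q_mod
  rw [Int.odd_iff]
  omega

theorem odd_c : Odd c := by
  have := h.c_mod
  rw [Int.odd_iff]
  omega

theorem odd_y : Odd y := by
  have := h.y_mod
  rw [Int.odd_iff]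
  omega

theorem odd_x : Odd x := odd_of_four_mul_eq h.odd_q h.odd_y h.eq

theorem odd_add : Odd (x + 2 * d) := h.odd_x.add_even (even_two_mul d)

theorem isSemiprimary_pi : IsSemiprimary ⟨c, d⟩ := ⟨h.odd_c, h.even_d⟩

theorem isSemiprimary_lam : IsSemiprimary Λ := ⟨h.odd_add, even_two_mul (-c)⟩

theorem isCoprime_re_im_lam : IsCoprime (x + 2 * d) (2 * -c) :=
  (Int.isCoprime_two_right.2 h.odd_add).mul_right h.isCoprime_c.symm.neg_right

theorem norm_lam : Zsqrtd.norm Λ = 2 * x * (x + 2 * d) + q * y ^ 2 := by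
  rw [norm_eq_re_sq_add_im_sq]
  linear_combination h.eq

theorem isCoprime_y_x : IsCoprime y x :=
  ((IsCoprime.pow_right_iff two_pos).1 h.isCoprime_x.of_mul_right_right).symm

theorem isCoprime_add_q_mul_y_sq : IsCoprime (x + 2 * d) (q * y ^ 2) := by
  have := h.isCoprime_re_im_lam.pow_right (n := 2)
  rwa [show (2 * -c) ^ 2 = q * y ^ 2 + (x + 2 * d) * (x - 2 * d) by linear_combination h.eq,
    IsCoprime.add_mul_left_right_iff] at this

theorem isCoprime_y_add : IsCoprime y (x + 2 * d) :=
  ((IsCoprime.pow_right_iff two_pos).1 h.isCoprime_add_q_mul_y_sq.of_mul_right_right).symm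

theorem isCoprime_lam_of_dvd {n : ℤ} (hn : Odd n) (hdvd : n ∣ q * y ^ 2) :
    IsCoprime (n : GaussianInt) Λ := by
  refine isCoprime_intCast_of_isCoprime_norm ?_
  obtain ⟨m, hm⟩ := hdvd
  rw [h.norm_lam, hm, IsCoprime.add_mul_left_right_iff]
  exact ((Int.isCoprime_two_right.2 hn).mul_right
    (h.isCoprime_x.of_isCoprime_of_dvd_right (Dvd.intro _ hm.symm)).symm).mul_right
    (h.isCoprime_add_q_mul_y_sq.of_isCoprime_of_dvd_right (Dvd.intro _ hm.symm)).symm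

theorem isCoprime_x_lam : IsCoprime (x : GaussianInt) Λ := by
  refine isCoprime_intCast_of_isCoprime_norm ?_
  rw [h.norm_lam, mul_comm 2, mul_assoc, add_comm, IsCoprime.add_mul_left_right_iff]
  exact h.isCoprime_x

theorem isCoprime_sq_add_sq {n : ℤ} (hn : IsCoprime n (x ^ 2 + q * y ^ 2)) :
    IsCoprime n (c ^ 2 + d ^ 2) := (h.eq ▸ hn).of_mul_right_right

theorem isCoprime_x_sq_add_sq : IsCoprime x (c ^ 2 + d ^ 2) := by
  refine h.isCoprime_sq_add_sq ?_
  rw [sq, add_comm, IsCoprime.add_mul_left_right_iff]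
  exact h.isCoprime_x

theorem isCoprime_y_sq_add_sq : IsCoprime y (c ^ 2 + d ^ 2) := by
  refine h.isCoprime_sq_add_sq ?_
  rw [sq y, mul_left_comm, IsCoprime.add_mul_left_right_iff]
  exact h.isCoprime_y_x.pow_right

theorem isCoprime_x_pi : IsCoprime (x : GaussianInt) ⟨c, d⟩ :=
  isCoprime_intCast_of_isCoprime_norm <|
    norm_eq_re_sq_add_im_sq ⟨c, d⟩ ▸ h.isCoprime_x_sq_add_sq

theorem isCoprime_y_pi : IsCoprime (y : GaussianInt) ⟨c, d⟩ :=
  isCoprime_intCast_of_isCoprime_norm <|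
    norm_eq_re_sq_add_im_sq ⟨c, d⟩ ▸ h.isCoprime_y_sq_add_sq

theorem symbolRat_eq_neg :
    quarticJacobiSymbolRat ((2 * c : ℚ) / (x + 2 * d : ℚ)) 1 q = -J₄(Λ, q) := by
  have hne : x + 2 * d ≠ 0 := fun h0 => by simpa [h0] using h.odd_add
  have hcop : IsCoprime (2 * c) (x + 2 * d) := by
    simpa [IsCoprime.neg_left_iff] using h.isCoprime_re_im_lam.symm
  have hI : J₄(I, (q : GaussianInt)) = -1 := by
    have hq : ZMod.χ₈ q = -1 := by
      rw [ZMod.χ₈_int_mod_eight, h.q_mod]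
      decide
    rw [quarticJacobiSymbol_I_intCast h.odd_q, hq, Int.cast_neg, Int.cast_one]
  have hrat := quarticJacobiSymbolRat_div_one hne hcop h.odd_q
    h.isCoprime_add_q_mul_y_sq.of_mul_right_left
  push_cast at hrat
  rw [hrat, show (⟨2 * c, x + 2 * d⟩ : GaussianInt) = I * Λ by ext <;> simp [I],
    quarticJacobiSymbol_mul (odd_norm_intCast h.odd_q), hI, neg_one_mul]

theorem symbol_neg_one_lam : J₄(-1, Λ) = -1 := by
  rw [quarticJacobiSymbol_neg_one h.odd_add, Int.negOnePow_odd _ h.odd_c.neg]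
  simp

theorem symbol_neg_q_lam : J₄(((-q : ℤ) : GaussianInt), Λ) = J₄(Λ, q) := by
  have hq := h.q_mod
  rw [← quarticJacobiSymbol_reciprocity h.odd_q h.isSemiprimary_lam
    (h.isCoprime_lam_of_dvd h.odd_q (dvd_mul_right q _)),
    primaryAssociate_of_mod_four_eq_three (by omega)]

-- `Λ ^ 2 = -4 (x + 2 d) i (c + d i)` modulo `y`.
theorem symbol_y_lam_sq : J₄((y : GaussianInt), Λ) ^ 2 =
    ZMod.χ₈ y * J₄((y : GaussianInt), ⟨c, d⟩) := by
  have hodd := odd_norm_intCast h.odd_y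
  have hlam := quarticJacobiSymbol_reciprocity h.odd_y h.isSemiprimary_lam
    (h.isCoprime_lam_of_dvd h.odd_y ⟨q * y, by ring⟩)
  have hpi := quarticJacobiSymbol_reciprocity h.odd_y h.isSemiprimary_pi h.isCoprime_y_pi
  rw [primaryAssociate_of_mod_four_eq_one h.y_mod] at hlam hpi
  have hcongr : (y : GaussianInt) ∣
      Λ ^ 2 - ((2 ^ 2 * -(x + 2 * d) : ℤ) : GaussianInt) * (I * ⟨c, d⟩) := by
    rw [Zsqrtd.intCast_dvd]
    constructor
    · exact ⟨-(q * y), by simp [sq, I]; linear_combination -h.eq⟩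
    · exact ⟨0, by simp [sq, I]; ring⟩
  have hcop : IsCoprime (2 ^ 2 * -(x + 2 * d)) y :=
    (Int.isCoprime_two_left.2 h.odd_y).pow_left.mul_left h.isCoprime_y_add.symm.neg_left
  rw [hlam, hpi, ← quarticJacobiSymbol_pow hodd, quarticJacobiSymbol_congr hodd hcongr,
    quarticJacobiSymbol_mul hodd, quarticJacobiSymbol_mul hodd,
    quarticJacobiSymbol_intCast_intCast h.odd_y hcop, quarticJacobiSymbol_I_intCast h.odd_y,
    one_mul]

-- `Λ = -2 i (c + d i)` modulo `x`.
theorem symbol_primaryAssociate_x_lam : J₄((primaryAssociate x : GaussianInt), Λ) =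
    ZMod.χ₈ x * J₄((primaryAssociate x : GaussianInt), ⟨c, d⟩) := by
  have hodd := odd_norm_intCast h.odd_x
  have hcongr : (x : GaussianInt) ∣ Λ - ((-2 : ℤ) : GaussianInt) * (I * ⟨c, d⟩) :=
    ⟨1, by ext <;> simp [I]⟩
  rw [quarticJacobiSymbol_reciprocity h.odd_x h.isSemiprimary_lam h.isCoprime_x_lam,
    quarticJacobiSymbol_reciprocity h.odd_x h.isSemiprimary_pi h.isCoprime_x_pi,
    quarticJacobiSymbol_congr hodd hcongr, quarticJacobiSymbol_mul hodd,
    quarticJacobiSymbol_mul hodd, quarticJacobiSymbol_intCast_intCast h.odd_x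
      (Int.isCoprime_two_left.2 h.odd_x).neg_left, quarticJacobiSymbol_I_intCast h.odd_x, one_mul]

theorem chi₈_add_mul_chi₈ :
    ZMod.χ₈ (x + 2 * d : ℤ) * ZMod.χ₈ (x + 2 * d - 2 * -c : ℤ) = -ZMod.χ₄ (x + 2 * d : ℤ) := by
  have hodd := Int.odd_iff.1 h.odd_add
  have hc := h.c_mod
  simp only [ZMod.χ₈_int_eq_if_mod_eight, ZMod.χ₄_int_eq_if_mod_four]
  split_ifs <;> omega

theorem chi₈_mul_chi₈_add :
    ZMod.χ₈ x * ZMod.χ₈ (x + 2 * d : ℤ) = ((d / 2).negOnePow : ℤ) := by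
  have hx := Int.odd_iff.1 h.odd_x
  have hd := Int.even_iff.1 h.even_d
  simp only [ZMod.χ₈_int_eq_if_mod_eight]
  rcases Int.even_or_odd (d / 2) with hb | hb
  · rw [Int.negOnePow_even _ hb, Units.val_one]
    rw [Int.even_iff] at hb
    split_ifs <;> omega
  · rw [Int.negOnePow_odd _ hb, Units.val_neg, Units.val_one]
    rw [Int.odd_iff] at hb
    split_ifs <;> omega

theorem symbol_two_mul_symbol_add_lam :
    J₄(2, Λ) * J₄(((x + 2 * d : ℤ) : GaussianInt), Λ) = -(ZMod.χ₈ (x + 2 * d : ℤ) * I) := by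
  have htwo := quarticJacobiSymbol_two h.isSemiprimary_lam h.isCoprime_re_im_lam
  have hadd := quarticJacobiSymbol_primaryAssociate_re h.isSemiprimary_lam h.isCoprime_re_im_lam
  rw [quarticJacobiSymbol_primaryAssociate_of_neg_one h.isSemiprimary_lam.odd_norm
    h.symbol_neg_one_lam h.odd_add] at hadd
  rw [quarticJacobiSymbol_I_of_odd h.odd_add h.odd_c.neg] at htwo
  have hchi := congrArg (Int.cast : ℤ → GaussianInt) h.chi₈_add_mul_chi₈
  simp only [Int.cast_mul, Int.cast_neg (R := GaussianInt)] at hchi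
  linear_combination J₄(((x + 2 * d : ℤ) : GaussianInt), Λ) * (htwo + I * hchi) - I * hadd

theorem symbol_neg_q_lam_mul_symbol_y_lam_sq :
    J₄(((-q : ℤ) : GaussianInt), Λ) * J₄((y : GaussianInt), Λ) ^ 2 =
      J₄((x : GaussianInt), Λ) * (J₄(2, Λ) * J₄(((x + 2 * d : ℤ) : GaussianInt), Λ)) := by
  have hodd := h.isSemiprimary_lam.odd_norm
  have hcongr : Λ ∣ ((-q : ℤ) : GaussianInt) * y ^ 2 - x * (2 * (x + 2 * d : ℤ)) := by
    refine ⟨-star Λ, ?_⟩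
    rw [mul_neg, ← Zsqrtd.norm_eq_mul_conj, h.norm_lam]
    push_cast
    ring
  simpa only [quarticJacobiSymbol_mul hodd, quarticJacobiSymbol_pow hodd]
    using quarticJacobiSymbol_congr hodd hcongr

theorem sq_add_sq_emod_four : (c ^ 2 + d ^ 2) % 4 = 1 := by
  obtain ⟨b, rfl⟩ := h.even_d
  have hc := Int.sq_mod_four_eq_one_of_odd h.odd_c
  rw [show (b + b) ^ 2 = 4 * b ^ 2 by ring]
  omega

theorem negOnePow_q : (((q - 3) / 8).negOnePow : ℤ) = ZMod.χ₈ x * ZMod.χ₈ y := by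
  rw [chi₈_eq_negOnePow h.odd_x, chi₈_eq_negOnePow h.odd_y, ← Units.val_mul, ← Int.negOnePow_add]
  congr 1
  rw [Int.negOnePow_eq_iff]
  obtain ⟨s, hs⟩ := Int.eight_dvd_sq_sub_one_of_odd h.odd_x
  obtain ⟨t, ht⟩ := Int.eight_dvd_sq_sub_one_of_odd h.odd_y
  obtain ⟨m, hm⟩ : (8 : ℤ) ∣ q - 3 := by
    have := h.q_mod
    omega
  have hcd := h.sq_add_sq_emod_four
  have hsum : c ^ 2 + d ^ 2 = 2 * (s + t + m) + 4 * (t + 4 * m * t) + 1 := by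
    linarith [h.eq, congrArg (· * y ^ 2) hm, congrArg (m * ·) ht]
  rw [hm, hs, ht, Int.even_iff]
  omega

theorem symbol_neg_one_pi : J₄(-1, ⟨c, d⟩) = ((d / 2).negOnePow : ℤ) := by
  have := quarticJacobiSymbol_neg_one h.odd_c (d / 2)
  rwa [Int.two_mul_ediv_two_of_even h.even_d] at this

theorem symbol_lam_q_mul_symbol_y_pi :
    J₄(Λ, q) * (ZMod.χ₈ y * J₄((y : GaussianInt), ⟨c, d⟩)) =
      -(((d / 2).negOnePow : ℤ) * I *
        (ZMod.χ₄ x * J₄((primaryAssociate x : GaussianInt), ⟨c, d⟩))) := by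
  have hrel := h.symbol_neg_q_lam_mul_symbol_y_lam_sq
  rw [h.symbol_neg_q_lam, h.symbol_y_lam_sq, h.symbol_two_mul_symbol_add_lam] at hrel
  have hx := h.symbol_primaryAssociate_x_lam
  rw [quarticJacobiSymbol_primaryAssociate_of_neg_one h.isSemiprimary_lam.odd_norm
    h.symbol_neg_one_lam h.odd_x] at hx
  have hchi := congrArg (Int.cast : ℤ → GaussianInt) h.chi₈_mul_chi₈_add
  have hchi₄ := congrArg (Int.cast : ℤ → GaussianInt) (chi₄_mul_self h.odd_x)
  rw [Int.cast_mul] at hchi hchi₄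
  rw [Int.cast_one] at hchi₄
  set xπ := J₄((primaryAssociate x : GaussianInt), ⟨c, d⟩)
  set xΛ := J₄((x : GaussianInt), Λ)
  set χA : GaussianInt := ((ZMod.χ₈ (x + 2 * d : ℤ) : ℤ) : GaussianInt)
  rw [hrel]
  linear_combination -ZMod.χ₄ x * χA * I * hx + χA * I * xΛ * hchi₄ - ZMod.χ₄ x * I * xπ * hchi

theorem symbol_lam_q_mul_symbol_y_pi_of_even (hd : Even (d / 2)) :
    J₄(Λ, q) * (ZMod.χ₈ y * J₄((y : GaussianInt), ⟨c, d⟩)) =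
      -(I * (ZMod.χ₄ x * J₄((x : GaussianInt), ⟨c, d⟩))) := by
  have hsign := h.symbol_neg_one_pi
  have hrel := h.symbol_lam_q_mul_symbol_y_pi
  rw [Int.negOnePow_even _ hd, Units.val_one, Int.cast_one] at hsign hrel
  rw [hrel, quarticJacobiSymbol_primaryAssociate_of_one h.isSemiprimary_pi.odd_norm hsign h.odd_x,
    one_mul]

theorem symbol_lam_q_mul_symbol_y_pi_of_odd (hd : Odd (d / 2)) :
    J₄(Λ, q) * (ZMod.χ₈ y * J₄((y : GaussianInt), ⟨c, d⟩)) =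
      I * J₄((x : GaussianInt), ⟨c, d⟩) := by
  have hsign := h.symbol_neg_one_pi
  have hrel := h.symbol_lam_q_mul_symbol_y_pi
  rw [Int.negOnePow_odd _ hd, Units.val_neg, Units.val_one, Int.cast_neg, Int.cast_one]
    at hsign hrel
  have hchi₄ := congrArg (Int.cast : ℤ → GaussianInt) (chi₄_mul_self h.odd_x)
  rw [Int.cast_mul, Int.cast_one] at hchi₄
  rw [hrel, quarticJacobiSymbol_primaryAssociate_of_neg_one h.isSemiprimary_pi.odd_norm hsign
    h.odd_x]
  linear_combination I * J₄((x : GaussianInt), ⟨c, d⟩) * hchi₄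

theorem negOnePow_div_four_add : ((x / 4 + (q - 3) / 8).negOnePow : ℤ) = ZMod.χ₄ x * ZMod.χ₈ y := by
  rw [Int.negOnePow_add, Units.val_mul, ← chi₄_mul_chi₈_eq_negOnePow h.odd_x, h.negOnePow_q,
    ← mul_assoc, mul_assoc (ZMod.χ₄ x), chi₈_mul_self h.odd_x, mul_one]

theorem negOnePow_sq_sub_one_div_add :
    (((x ^ 2 - 1) / 8 + (q - 3) / 8).negOnePow : ℤ) = ZMod.χ₈ y := by
  rw [Int.negOnePow_add, Units.val_mul, ← chi₈_eq_negOnePow h.odd_x, h.negOnePow_q,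
    ← mul_assoc, chi₈_mul_self h.odd_x, one_mul]

theorem even_div_two (h8 : (c ^ 2 + d ^ 2) % 8 = 1) : Even (d / 2) := by
  by_contra hodd
  rw [Int.not_even_iff_odd] at hodd
  have hb := Int.sq_mod_four_eq_one_of_odd hodd
  have hc := Int.eight_dvd_sq_sub_one_of_odd h.odd_c
  rw [← Int.two_mul_ediv_two_of_even h.even_d, mul_pow] at h8
  omega

theorem odd_div_two (h8 : (c ^ 2 + d ^ 2) % 8 = 5) : Odd (d / 2) := by
  by_contra heven
  obtain ⟨b, hb⟩ := Int.not_odd_iff_even.1 heven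
  have hc := Int.eight_dvd_sq_sub_one_of_odd h.odd_c
  rw [← Int.two_mul_ediv_two_of_even h.even_d, hb,
    show (2 * (b + b)) ^ 2 = 16 * b ^ 2 by ring] at h8
  omega

section Reduction

variable {p : ℕ} [Fact p.Prime] (hp : (p : ℤ) = c ^ 2 + d ^ 2)
include hp

theorem cast_x_ne_zero : (x : ZMod p) ≠ 0 :=
  ((ZMod.coe_int_isUnit_iff_isCoprime x p).2 (hp ▸ h.isCoprime_x_sq_add_sq.symm)).ne_zero

theorem cast_y_ne_zero : (y : ZMod p) ≠ 0 :=
  ((ZMod.coe_int_isUnit_iff_isCoprime y p).2 (hp ▸ h.isCoprime_y_sq_add_sq.symm)).ne_zero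

theorem neg_cast_q_eq_sq : -(q : ZMod p) = ((x : ZMod p) / y) ^ 2 := by
  have hy := h.cast_y_ne_zero hp
  have heq := congrArg (Int.cast : ℤ → ZMod p) h.eq
  rw [← hp] at heq
  push_cast at heq
  rw [ZMod.natCast_self, mul_zero] at heq
  field_simp
  linear_combination heq

variable {φ : GaussianInt →+* ZMod p} (hφ : φ ⟨c, d⟩ = 0)
include hφ

theorem map_symbol_pi (n : ℤ) :
    φ J₄((n : GaussianInt), ⟨c, d⟩) = (n : ZMod p) ^ ((p - 1) / 4) :=
  map_quarticJacobiSymbol_intCast Fact.out (by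
    have := h.sq_add_sq_emod_four
    rw [Nat.odd_iff]
    omega) ((norm_eq_re_sq_add_im_sq _).trans hp.symm) hφ n

theorem neg_cast_q_pow_of_mod_eight_eq_one (hp8 : p % 8 = 1) :
    (-(q : ZMod p)) ^ (p / 8) = ZMod.χ₄ x * ZMod.χ₈ y * (φ (-J₄(Λ, q)) / φ I) := by
  have hrel := congrArg φ (h.symbol_lam_q_mul_symbol_y_pi_of_even (h.even_div_two (by omega)))
  simp only [map_mul, map_neg, map_intCast, h.map_symbol_pi hp hφ] at hrel
  have hchi₄ := congrArg (Int.cast : ℤ → ZMod p) (chi₄_mul_self h.odd_x)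
  rw [Int.cast_mul, Int.cast_one] at hchi₄
  have hy := pow_ne_zero ((p - 1) / 4) (h.cast_y_ne_zero hp)
  have hI := map_I_ne_zero φ
  rw [h.neg_cast_q_eq_sq hp, ← pow_mul, show 2 * (p / 8) = (p - 1) / 4 by omega, div_pow,
    ← mul_div_assoc, div_eq_div_iff hy hI, map_neg]
  linear_combination ZMod.χ₄ x * hrel - x ^ ((p - 1) / 4) * φ I * hchi₄

theorem neg_cast_q_pow_of_mod_eight_eq_five (hp8 : p % 8 = 5) :
    (-(q : ZMod p)) ^ (p / 8) = -ZMod.χ₈ y * (φ (-J₄(Λ, q)) / φ I) * (y / x) := by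
  have hrel := congrArg φ (h.symbol_lam_q_mul_symbol_y_pi_of_odd (h.odd_div_two (by omega)))
  simp only [map_mul, map_intCast, h.map_symbol_pi hp hφ] at hrel
  have hx := h.cast_x_ne_zero hp
  have hy := h.cast_y_ne_zero hp
  have hI := map_I_ne_zero φ
  rw [show (p - 1) / 4 = 2 * (p / 8) + 1 by omega, pow_succ, pow_succ] at hrel
  rw [h.neg_cast_q_eq_sq hp, ← pow_mul, div_pow, map_neg]
  generalize φ J₄(Λ, q) = w at hrel ⊢
  field_simp
  linear_combination -hrel

end Reduction

end RepresentationPair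

end QuarticReciprocity

theorem theorem3p1 (p : ℕ) [Fact p.Prime] (hp : p % 4 = 1) (q : ℤ) (hq : q ≡ 3 [ZMOD 8])
    (hpq : ¬ (p : ℤ) ∣ q) (c d x y : ℤ)
    (hcd : (p : ℤ) = c ^ 2 + d ^ 2) (hxy : 4 * (p : ℤ) = x ^ 2 + q * y ^ 2)
    (hc : c ≡ 1 [ZMOD 4]) (hy : y ≡ 1 [ZMOD 4])
    (hgcd : Int.gcd c (x + 2 * d) = 1) (k : ℤ)
    (hk : GaussianInt.toComplex
        (quarticJacobiSymbolRat ((2 * c : ℚ) / (x + 2 * d : ℚ)) 1 (q : GaussianInt)) =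
      Complex.I ^ k) :
    (p % 8 = 1 →
      (-(q : ZMod p)) ^ (p / 8) =
        (-1 : ZMod p) ^ (x / 4 + (q - 3) / 8) * ((d : ZMod p) / (c : ZMod p)) ^ (k - 1)) ∧
    (p % 8 = 5 →
      (-(q : ZMod p)) ^ (p / 8) =
        -((-1 : ZMod p) ^ ((x ^ 2 - 1) / 8 + (q - 3) / 8)) *
          ((d : ZMod p) / (c : ZMod p)) ^ (k - 1) * ((y : ZMod p) / (x : ZMod p))) := by
  have h := QuarticReciprocity.RepresentationPair.of_prime
    (Nat.prime_iff_prime_int.1 Fact.out) (by omega) hq hpq hcd hxy hc hy hgcd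
  obtain ⟨φ, hI, hφ⟩ := QuarticReciprocity.exists_ringHom_zmod_map_I_eq_div hcd
  have hI_ne_zero := QuarticReciprocity.map_I_ne_zero φ
  have hsymbol := QuarticReciprocity.map_eq_zpow_of_toComplex_eq φ hk
  rw [h.symbolRat_eq_neg] at hsymbol
  rw [← hI, zpow_sub_one₀ hI_ne_zero, ← hsymbol, ← div_eq_mul_inv, ← Int.cast_negOnePow,
    ← Int.cast_negOnePow, h.negOnePow_div_four_add, h.negOnePow_sq_sub_one_div_add, Int.cast_mul]
  exact ⟨h.neg_cast_q_pow_of_mod_eight_eq_one hcd hφ, h.neg_cast_q_pow_of_mod_eight_eq_five hcd hφ⟩
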